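/- **Setting.** Let $V$ be a finite-dimensional real vector space, $I$ a finite set, $(\alpha_i)_{i\in I}$ a linearly independent family in $V^*$ and $(\alpha_i^\vee)_{i\in I}$ a family in $V$ with $\alpha_i(\alpha_i^\vee)=2$. Put $r_i(v)=v-\alpha_i(v)\alpha_i^\vee$, let $W^v\subset GL(V)$ be the group generated by the $r_i$, and let $\Phi=\{w\alpha_i\mid w\in W^v,\ i\in I\}$ and $Q_+=\sum_i\mathbb R_{\ge0}\alpha_i$. Assume that $(W^v,\{r_i\})$ is a Coxeter system (with length $\ell$), that $\Phi\subset Q_+\cup -Q_+$, that $w\alpha_i\in Q_+\Leftrightarrow \ell(wr_i)>\ell(w)$, and that $\Phi\cap\mathbb R_{>0}\alpha=\{\alpha\}$ for $\alpha\in\Phi$. Let $\Delta_{im}\subset V^*\setminus\{0\}$ be a set of imaginary roots, disjoint from $\mathbb R\Phi$, stable under $\pm W^v$, contained in $Q_+\cup-Q_+$ and such that $\Delta_{im}\cap Q_+$ is $W^v$-stable (moderately imaginary case); put $\Delta=\Phi\cup\Delta_{im}$. The positive vectorial facets are the sets $wF^v(J)$, for $w\in W^v$, $J\subset I$ and $F^v(J)=\{v\mid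 \alpha_i(v)=0\ (i\in J),\ \alpha_i(v)>0\ (i\notin J)\}$; they are spherical if $\langle r_i\mid i\in J\rangle$ is finite. The negative facets are their opposites. The Tits cone $\mathcal T$ is the union of the positive facets. The model apartment $\mathbb A$ is the affine space $V$ with a set $\mathcal M$ of affine hyperplanes (walls) such that each wall has the form $M(\alpha,k)=\{\alpha+k=0\}$ with $\alpha\in\Phi$; for each $\alpha\in\Phi$ the set $\Gamma_\alpha$ of the $k$ with $M(\alpha,k)\in\mathcal M$ is infinite; and the group $W$ generated by the reflections $v\mapsto v-(\alpha(v)+k)\alpha^\vee$ in the walls (where $\alpha^\vee=w\alpha_i^\vee$ for $\alpha=w\alpha_i$) stabilizes $\mathcal M$. For $\alpha\in\Delta_{im}$ put $\Gamma_\alpha=\mathbb R$. Let $D(\alpha,k)=\{\alpha+k\ge0\}$, $D^\circ(\alpha,k)=\{\alpha+k>0\}$, both equal to $\mathbb A$ if $k=\infty$. Subsets are identified with principal filters; a filter is contained in a set if the set is one of its elements. The enclosure $cl(G)$ of a filter $G$ is the filter of the sets that contain an element of $G$ of the form $\bigcap_{\alpha\in\Delta}D(\alpha,k_\alpha)$,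 $k_\alpha\in\Gamma_\alpha\cup\{\infty\}$. The facet $F(x,F^v)$ is the filter of the sets containing an intersection, over $\alpha\in\Delta$, of one $D(\alpha,k_\alpha)$ or $D^\circ(\alpha,k_\alpha)$ each ($k_\alpha\in\Gamma_\alpha\cup\{\infty\}$), which contains the germ of $x+F^v$ at $x$. A chimney is a filter $cl(F+F^v)$, with $F$ a facet and $F^v$ a vectorial facet; its germ is the filter of the sets containing $cl(F+\xi+F^v)$ for some $\xi\in\overline{F^v}$. It is splayed if $F^v$ is spherical, and solid if the direction of its support (the smallest affine subspace containing it) has a finite pointwise fixer in $W^v$. An apartment of type $\mathbb A$ is a set $A$ with a nonempty set of bijections $\mathbb A\to A$ of the form $\{f_0\circ w\mid w\in W\}$; all the notions above are transported to $A$, and the isomorphisms of apartments are the bijections compatible with these sets. An affine hovel (masure affine) of type $\mathbb A$ is a set $\mathcal I$ covered by a set of subsets, called apartments, such that: * (MA1) every apartment has a structure of apartment of type $\mathbb A$; * (MA2) if $F$ is a point, a germ at $x$ of an interval $]x,y]$ with $0\neq y-x\in\pm\mathcal T$, a generic half-line (one whose direction vector is nonzero and lies in a spherical vectorial facet) or a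 solid chimney of an apartment $A$, and $A'$ is an apartment containing $F$, then $A\cap A'$ contains $cl_A(F)$ and there is an isomorphism $A\to A'$ fixing (pointwise some element of) $cl_A(F)$; * (MA3) if $\mathfrak R$ is a germ of splayed chimney and $F$ is a facet or a germ of solid chimney, some apartment contains $\mathfrak R$ and $F$; * (MA4) if $A,A'$ are apartments containing $\mathfrak R$ and $F$ as in (MA3), then $A\cap A'$ contains $cl_A(\mathfrak R\cup F)$ and there is an isomorphism $A\to A'$ fixing this enclosure. A spherical sector face $\mathfrak f$ of $\mathcal I$ is a subset which is, in some apartment, of the form $x+F^v$ with $F^v$ a spherical vectorial facet (of either sign); its closure $\overline{\mathfrak f}$ is $x+\overline{F^v}$, and its germ $\mathrm{germ}_\infty(\mathfrak f)$ is the filter of the sets containing $x+\xi+F^v$ for some $\xi\in\overline{F^v}$. For spherical sector faces $\mathfrak f,\mathfrak f'$, one says that $\mathfrak f$ is parallel to $\mathfrak f'$ ($\mathfrak f\parallel\mathfrak f'$), resp. opposite to $\mathfrak f'$ ($\mathfrak f\ \mathrm{opp}\ \mathfrak f'$), resp. dominates $\mathfrak f'$ ($\mathfrak f\ge\mathfrak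 f'$), if in an apartment containing both germs these are $\mathrm{germ}_\infty(x+F^v)$ and $\mathrm{germ}_\infty(y+F^v)$, resp. $\mathrm{germ}_\infty(x+F^v)$ and $\mathrm{germ}_\infty(y-F^v)$, resp. $\mathrm{germ}_\infty(x+F^v)$ and $\mathrm{germ}_\infty(y+F'^v)$ with $F'^v\subset\overline{F^v}$, for some points $x,y$ and spherical vectorial facets $F^v,F'^v$. **Proposition 3.2.** Let $\mathcal I$ be an affine hovel. All letters $\mathfrak f$ below denote spherical sector faces of $\mathcal I$. 1. Parallelism is an equivalence relation on the spherical sector faces. 2. Dominance is a preorder on the spherical sector faces, compatible with parallelism ($\mathfrak f_1\parallel\mathfrak f\ge\mathfrak f'\parallel\mathfrak f_1'\Rightarrow\mathfrak f_1\ge\mathfrak f_1'$), and parallelism is the associated equivalence relation: $\mathfrak f\parallel\mathfrak f'\Leftrightarrow(\mathfrak f\ge\mathfrak f'\text{ and }\mathfrak f'\ge\mathfrak f)$. Moreover $$\mathfrak f\ge\mathfrak f'\iff\exists\,\mathfrak f_1'\parallel\mathfrak f',\ \mathfrak f_1'\subset\overline{\mathfrak f}\iff\exists\,\mathfrak f_1\parallel\mathfrak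 f,\ \mathfrak f'\subset\overline{\mathfrak f_1}.$$ 3. Opposition is symmetric, and compatible with parallelism and dominance: $\mathfrak f_1\parallel\mathfrak f\ \mathrm{opp}\ \mathfrak f'\parallel\mathfrak f_1'\Rightarrow\mathfrak f_1\ \mathrm{opp}\ \mathfrak f_1'$ and, for all $\mathfrak f,\mathfrak f''$, $$(\exists\,\mathfrak f',\ \mathfrak f\ \mathrm{opp}\ \mathfrak f'\ge\mathfrak f'')\iff(\exists\,\mathfrak f_1',\ \mathfrak f\ge\mathfrak f_1'\ \mathrm{opp}\ \mathfrak f''),$$ $$(\exists\,\mathfrak f',\ \mathfrak f\ \mathrm{opp}\ \mathfrak f'\le\mathfrak f'')\iff(\exists\,\mathfrak f_1',\ \mathfrak f\le\mathfrak f_1'\ \mathrm{opp}\ \mathfrak f'').$$ -/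

import Mathlib

open Set Filter Topology
open scoped Pointwise

namespace Hovel

/-! ### The vectorial Weyl group, roots and vectorial facets -/

/-- Simple roots `α i` in the dual of `V` and simple coroots in `V`, with `α i (α i)^∨ = 2`. -/
structure SimpleRoots (V ι : Type*) [AddCommGroup V] [Module ℝ V] where
  root : ι → Module.Dual ℝ V
  coroot : ι → V
  root_coroot : ∀ i, root i (coroot i) = 2

namespace SimpleRoots

variable {V ι : Type*} [AddCommGroup V] [Module ℝ V] (D : SimpleRoots V ι)

/-- The simple reflection `v ↦ v - α i (v) • (α i)^∨`. -/
noncomputable def refl (i : ι) : V ≃ₗ[ℝ] V := Module.reflection (D.root_coroot i)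

/-- The vectorial Weyl group, generated by the simple reflections. -/
def Wv : Subgroup (V ≃ₗ[ℝ] V) := Subgroup.closure (range D.refl)

/-- The standard parabolic subgroup attached to `J`. -/
def parabolic (J : Set ι) : Subgroup (V ≃ₗ[ℝ] V) := Subgroup.closure (D.refl '' J)

/-- The contragredient action on linear forms, `β ↦ β ∘ w⁻¹`. -/
def act (w : V ≃ₗ[ℝ] V) (β : Module.Dual ℝ V) : Module.Dual ℝ V :=
  β ∘ₗ (w.symm : V →ₗ[ℝ] V)

/-- The real roots: the forms `w (α i)`. -/
def realRoots : Set (Module.Dual ℝ V) := {β | ∃ w ∈ D.Wv, ∃ i, β = act w (D.root i)}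

/-- The linear forms that are combinations of simple roots with nonnegative coefficients. -/
def posCone [Fintype ι] : Set (Module.Dual ℝ V) :=
  {β | ∃ c : ι → ℝ, (∀ i, 0 ≤ c i) ∧ β = ∑ i, c i • D.root i}

/-- The standard facet `F^v(J)` of the closed fundamental chamber. -/
def stdFacet (J : Set ι) : Set V :=
  {v | (∀ i ∈ J, D.root i v = 0) ∧ ∀ i ∉ J, 0 < D.root i v}

/-- The Tits cone: the union of the positive vectorial facets. -/
def titsCone : Set V := {v | ∃ w ∈ D.Wv, ∃ J : Set ι, v ∈ w '' D.stdFacet J}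

/-- Vectorial facets, positive or negative. -/
def IsVFacet (F : Set V) : Prop :=
  ∃ w ∈ D.Wv, ∃ J : Set ι, F = w '' D.stdFacet J ∨ F = -(w '' D.stdFacet J)

/-- Spherical vectorial facets, positive or negative. -/
def IsSphericalVFacet (F : Set V) : Prop :=
  ∃ w ∈ D.Wv, ∃ J : Set ι, (D.parabolic J : Set (V ≃ₗ[ℝ] V)).Finite ∧
    (F = w '' D.stdFacet J ∨ F = -(w '' D.stdFacet J))

end SimpleRoots

/-- The vectorial data: a Coxeter group generated by the simple reflections, with its real roots,
and a set of imaginary roots, in the moderately imaginary case. -/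
structure VectorialDatum (V ι : Type*) [AddCommGroup V] [Module ℝ V] [Fintype ι] extends
    SimpleRoots V ι where
  linearIndependent_root : LinearIndependent ℝ root
  /-- `(W^v, {r_i})` is a Coxeter system, and `w (α i)` is positive if and only if
  `ℓ (w r_i) > ℓ (w)`. -/
  coxeter : ∃ (M : CoxeterMatrix ι) (cs : CoxeterSystem M toSimpleRoots.Wv),
    (∀ i, (cs.simple i : V ≃ₗ[ℝ] V) = toSimpleRoots.refl i) ∧
    ∀ (w : toSimpleRoots.Wv) (i : ι),
      SimpleRoots.act (w : V ≃ₗ[ℝ] V) (root i) ∈ toSimpleRoots.posCone ↔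
        cs.length w < cs.length (w * cs.simple i)
  /-- Every real root is positive or negative. -/
  root_sign : ∀ β ∈ toSimpleRoots.realRoots,
    β ∈ toSimpleRoots.posCone ∨ -β ∈ toSimpleRoots.posCone
  /-- The only positive multiple of a real root that is a real root is itself. -/
  root_reduced : ∀ β ∈ toSimpleRoots.realRoots, ∀ c : ℝ, 0 < c →
    c • β ∈ toSimpleRoots.realRoots → c = 1
  /-- The imaginary roots. -/
  imRoots : Set (Module.Dual ℝ V)
  imRoots_ne_zero : ∀ β ∈ imRoots, β ≠ 0
  imRoots_disjoint : ∀ β ∈ toSimpleRoots.realRoots, ∀ c : ℝ, c • β ∉ imRoots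
  imRoots_neg : ∀ β ∈ imRoots, -β ∈ imRoots
  imRoots_act : ∀ w ∈ toSimpleRoots.Wv, ∀ β ∈ imRoots, SimpleRoots.act w β ∈ imRoots
  /-- Every imaginary root is positive or negative. -/
  imRoots_sign : ∀ β ∈ imRoots,
    β ∈ toSimpleRoots.posCone ∨ -β ∈ toSimpleRoots.posCone
  /-- The set of positive imaginary roots is stable under the vectorial Weyl group. -/
  imRoots_pos : ∀ w ∈ toSimpleRoots.Wv, ∀ β ∈ imRoots, β ∈ toSimpleRoots.posCone →
    SimpleRoots.act w β ∈ toSimpleRoots.posCone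

/-! ### The model apartment

The affine space under `V` is `V` itself, after the choice of an arbitrary origin. -/

/-- The affine hyperplane `M(β, k) = {v | β v + k = 0}`. -/
def hyperplane {V : Type*} [AddCommGroup V] [Module ℝ V] (β : Module.Dual ℝ V) (k : ℝ) : Set V :=
  {v | β v + k = 0}

/-- The affine Weyl group of a set of walls: it is generated by the reflections
`v ↦ v - (β v + k) • β^∨` in the walls `M(β, k)`, for `β = w (α i)` and `β^∨ = w ((α i)^∨)`. -/
def SimpleRoots.affineWeyl {V ι : Type*} [AddCommGroup V] [Module ℝ V] (D : SimpleRoots V ι)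
    (walls : Set (Set V)) : Subgroup (V ≃ᵃ[ℝ] V) :=
  Subgroup.closure {g | ∃ w ∈ D.Wv, ∃ (i : ι) (k : ℝ),
    hyperplane (SimpleRoots.act w (D.root i)) k ∈ walls ∧
    ∀ v, g v = v - (SimpleRoots.act w (D.root i) v + k) • w (D.coroot i)}

/-- The model affine apartment: vectorial data and a set of (real) walls. -/
structure Apartment (V ι : Type*) [AddCommGroup V] [Module ℝ V] [Fintype ι] extends
    VectorialDatum V ι where
  walls : Set (Set V)
  walls_direction : ∀ M ∈ walls, ∃ β ∈ toSimpleRoots.realRoots, ∃ k : ℝ, M = hyperplane β k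
  walls_infinite : ∀ β ∈ toSimpleRoots.realRoots, {k : ℝ | hyperplane β k ∈ walls}.Infinite
  walls_stable : ∀ g ∈ toSimpleRoots.affineWeyl walls, ∀ M ∈ walls, g '' M ∈ walls

namespace Apartment

variable {V ι : Type*} [NormedAddCommGroup V] [NormedSpace ℝ V] [Fintype ι] (𝔸 : Apartment V ι)

/-- The affine Weyl group `W`. -/
def W : Subgroup (V ≃ᵃ[ℝ] V) := 𝔸.toSimpleRoots.affineWeyl 𝔸.walls

/-- All roots, real or imaginary. -/
def roots : Set (Module.Dual ℝ V) := 𝔸.realRoots ∪ 𝔸.imRoots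

/-- `Γ_β ∪ {∞}`, where `Γ_β` is the set of `k` such that `M(β, k)` is a real wall if `β` is a
real root, and `Γ_β = ℝ` if `β` is an imaginary root. -/
def levels (β : Module.Dual ℝ V) : Set (WithTop ℝ) :=
  {k | k = ⊤ ∨ ∃ r : ℝ, k = (r : WithTop ℝ) ∧ (hyperplane β r ∈ 𝔸.walls ∨ β ∈ 𝔸.imRoots)}

/-- The half-space `D(β, k) = {v | β v + k ≥ 0}`, which is `V` for `k = ∞`. -/
def halfSpace (β : Module.Dual ℝ V) (k : WithTop ℝ) : Set V :=
  {v | ((-(β v) : ℝ) : WithTop ℝ) ≤ k}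

/-- The open half-space `D°(β, k) = {v | β v + k > 0}`, which is `V` for `k = ∞`. -/
def openHalfSpace (β : Module.Dual ℝ V) (k : WithTop ℝ) : Set V :=
  {v | ((-(β v) : ℝ) : WithTop ℝ) < k}

/-- The sets `⋂ β, D(β, k_β)`, with one `k_β ∈ Γ_β ∪ {∞}` for each root `β`. -/
def IsEnclosed (Q : Set V) : Prop :=
  ∃ k : Module.Dual ℝ V → WithTop ℝ, (∀ β ∈ 𝔸.roots, k β ∈ 𝔸.levels β) ∧
    Q = ⋂ β ∈ 𝔸.roots, halfSpace β (k β)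

/-- The intersections over all roots `β` of one half-space `D(β, k_β)` or `D°(β, k_β)`,
with `k_β ∈ Γ_β ∪ {∞}`; it is the open one for `β ∈ O`. -/
def IsSemiEnclosed (Q : Set V) : Prop :=
  ∃ (k : Module.Dual ℝ V → WithTop ℝ) (O : Set (Module.Dual ℝ V)),
    (∀ β ∈ 𝔸.roots, k β ∈ 𝔸.levels β) ∧
    Q = ⋂ β ∈ 𝔸.roots, {v | v ∈ halfSpace β (k β) ∧ (β ∈ O → v ∈ openHalfSpace β (k β))}

theorem isEnclosed_univ : 𝔸.IsEnclosed univ :=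
  ⟨fun _ => ⊤, fun _ _ => Or.inl rfl, by simp [halfSpace]⟩

theorem isSemiEnclosed_univ : 𝔸.IsSemiEnclosed univ :=
  ⟨fun _ => ⊤, ∅, fun _ _ => Or.inl rfl, by simp [halfSpace]⟩

theorem IsEnclosed.inter {Q R : Set V} (hQ : 𝔸.IsEnclosed Q) (hR : 𝔸.IsEnclosed R) :
    𝔸.IsEnclosed (Q ∩ R) := by
  obtain ⟨k, hk, rfl⟩ := hQ
  obtain ⟨l, hl, rfl⟩ := hR
  refine ⟨fun β => min (k β) (l β), fun β hβ => ?_, ?_⟩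
  · rcases min_choice (k β) (l β) with h | h <;> simp only [h]
    exacts [hk β hβ, hl β hβ]
  · ext v
    simp only [mem_inter_iff, mem_iInter, halfSpace, mem_ofPred_eq, le_min_iff]
    grind

theorem IsSemiEnclosed.inter {Q R : Set V} (hQ : 𝔸.IsSemiEnclosed Q)
    (hR : 𝔸.IsSemiEnclosed R) : 𝔸.IsSemiEnclosed (Q ∩ R) := by
  obtain ⟨k, O, hk, rfl⟩ := hQ
  obtain ⟨l, P, hl, rfl⟩ := hR
  refine ⟨fun β => min (k β) (l β),
    {β | (k β ≤ l β ∧ β ∈ O) ∨ (l β ≤ k β ∧ β ∈ P)}, fun β hβ => ?_, ?_⟩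
  · rcases min_choice (k β) (l β) with h | h <;> simp only [h]
    exacts [hk β hβ, hl β hβ]
  · ext v
    simp only [mem_inter_iff, mem_iInter, halfSpace, openHalfSpace, mem_ofPred_eq, le_min_iff,
      lt_min_iff, ← forall_and]
    refine forall_congr' fun β => forall_congr' fun _ => ?_
    rcases lt_trichotomy (k β) (l β) with h | h | h
    · have h1 := h.not_ge
      have h2 := h.le
      constructor
      · rintro ⟨⟨a, b⟩, c, d⟩
        exact ⟨⟨a, c⟩, by rintro (⟨_, e⟩ | ⟨e, _⟩); exacts [⟨b e, a.trans_lt h⟩, (h1 e).elim]⟩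
      · rintro ⟨⟨a, c⟩, b⟩
        exact ⟨⟨a, fun e => (b (Or.inl ⟨h2, e⟩)).1⟩, c, fun _ => a.trans_lt h⟩
    · simp only [h, le_refl, true_and, and_self]
      grind
    · have h1 := h.not_ge
      have h2 := h.le
      constructor
      · rintro ⟨⟨a, b⟩, c, d⟩
        exact ⟨⟨a, c⟩, by rintro (⟨e, _⟩ | ⟨_, e⟩); exacts [(h1 e).elim, ⟨c.trans_lt h, d e⟩]⟩
      · rintro ⟨⟨a, c⟩, b⟩
        exact ⟨⟨a, fun _ => c.trans_lt h⟩, c, fun e => (b (Or.inr ⟨h2, e⟩)).2⟩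

/-- The enclosure `cl(G)` of a filter `G`: the sets that contain an element of `G` of the form
`⋂ β, D(β, k_β)`. Here and below a subset of `V` is identified with its principal filter, and
"`G` is contained in `G'`" is `G ≤ G'`. -/
def cl (G : Filter V) : Filter V where
  sets := {S | ∃ Q, 𝔸.IsEnclosed Q ∧ Q ∈ G ∧ Q ⊆ S}
  univ_sets := ⟨univ, 𝔸.isEnclosed_univ, univ_mem, Subset.rfl⟩
  sets_of_superset := fun ⟨Q, h, hG, hQ⟩ hS => ⟨Q, h, hG, hQ.trans hS⟩
  inter_sets := fun ⟨Q, h, hG, hQ⟩ ⟨R, h', hG', hR⟩ =>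
    ⟨Q ∩ R, h.inter 𝔸 h', inter_mem hG hG', inter_subset_inter hQ hR⟩

/-- The facet `F(x, F^v)`: the sets that contain an intersection of half-spaces `D(β, k_β)` or
`D°(β, k_β)` which itself contains the local facet, the germ at `x` of `x + F^v`. -/
def facet (x : V) (F : Set V) : Filter V where
  sets := {S | ∃ Q, 𝔸.IsSemiEnclosed Q ∧ Q ∈ 𝓝[x +ᵥ F] x ∧ Q ⊆ S}
  univ_sets := ⟨univ, 𝔸.isSemiEnclosed_univ, univ_mem, Subset.rfl⟩
  sets_of_superset := fun ⟨Q, h, hG, hQ⟩ hS => ⟨Q, h, hG, hQ.trans hS⟩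
  inter_sets := fun ⟨Q, h, hG, hQ⟩ ⟨R, h', hG', hR⟩ =>
    ⟨Q ∩ R, h.inter 𝔸 h', inter_mem hG hG', inter_subset_inter hQ hR⟩

/-- The chimney `cl(F(x, F₀) + F)` with base `F(x, F₀)` and direction `F`. -/
def chimney (x : V) (F₀ F : Set V) : Filter V := 𝔸.cl (𝔸.facet x F₀ + 𝓟 F)

/-- The germ of a chimney: the sets that contain one of the shortened chimneys
`cl(F(x, F₀) + ξ + F)`, for `ξ` in the closure of `F` (a directed family). -/
def chimneyGerm (x : V) (F₀ F : Set V) : Filter V :=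
  ⨅ ξ ∈ closure F, 𝔸.cl (𝔸.facet x F₀ + 𝓟 (ξ +ᵥ F))

/-- The support of a filter: the smallest affine subspace that contains it. -/
def support (G : Filter V) : AffineSubspace ℝ V := sInf {E | (E : Set V) ∈ G}

/-- A filter is solid if the direction of its support has a finite pointwise fixer in `W^v`. -/
def IsSolid (G : Filter V) : Prop :=
  {w : V ≃ₗ[ℝ] V | w ∈ 𝔸.Wv ∧ ∀ v ∈ (support G).direction, w v = v}.Finite

/-- Solid chimneys. -/
def IsSolidChimney (G : Filter V) : Prop :=
  ∃ x F₀ F, 𝔸.IsVFacet F₀ ∧ 𝔸.IsVFacet F ∧ 𝔸.IsSolid (𝔸.chimney x F₀ F) ∧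
    G = 𝔸.chimney x F₀ F

/-- Germs of solid chimneys. -/
def IsSolidChimneyGerm (G : Filter V) : Prop :=
  ∃ x F₀ F, 𝔸.IsVFacet F₀ ∧ 𝔸.IsVFacet F ∧ 𝔸.IsSolid (𝔸.chimney x F₀ F) ∧
    G = 𝔸.chimneyGerm x F₀ F

/-- Germs of splayed chimneys: those with a spherical direction. -/
def IsSplayedChimneyGerm (G : Filter V) : Prop :=
  ∃ x F₀ F, 𝔸.IsVFacet F₀ ∧ 𝔸.IsSphericalVFacet F ∧ G = 𝔸.chimneyGerm x F₀ F

/-- Facets. -/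
def IsFacet (G : Filter V) : Prop := ∃ x F, 𝔸.IsVFacet F ∧ G = 𝔸.facet x F

/-- Points. -/
def IsPoint (G : Filter V) : Prop := ∃ x : V, G = 𝓟 {x}

/-- Germs at `x` of preordered intervals `]x, x + v]`, with `v ≠ 0` in plus or minus the
Tits cone. -/
def IsPreorderedIntervalGerm (G : Filter V) : Prop :=
  ∃ x v, v ≠ 0 ∧ (v ∈ 𝔸.titsCone ∨ -v ∈ 𝔸.titsCone) ∧
    G = 𝓝[(fun t : ℝ => x + t • v) '' Ioc 0 1] x

/-- Generic half-lines: those whose direction lies in a spherical vectorial facet. -/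
def IsGenericHalfLine (G : Filter V) : Prop :=
  ∃ x v, v ≠ 0 ∧ (∃ F, 𝔸.IsSphericalVFacet F ∧ v ∈ F) ∧
    G = 𝓟 ((fun t : ℝ => x + t • v) '' Ici 0)

/-- The germ at infinity of the sector face `x + F`: the sets that contain one of its shortenings
`x + ξ + F`, for `ξ` in the closure of `F` (a directed family). -/
def sectorFaceGerm (x : V) (F : Set V) : Filter V := ⨅ ξ ∈ closure F, 𝓟 ((x + ξ) +ᵥ F)

end Apartment

/-! ### Affine hovels -/

variable {V ι : Type*} [NormedAddCommGroup V] [NormedSpace ℝ V] [Fintype ι]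

/-- A set `X` covered by a set of subsets (apartments), each with a structure of apartment of
type `𝔸`, given by its set `isom A` of isomorphisms from `V` onto `A`. -/
structure ApartmentSystem (𝔸 : Apartment V ι) (X : Type*) where
  apts : Set (Set X)
  cover : ⋃₀ apts = univ
  isom : Set X → Set (V → X)
  isom_nonempty : ∀ A ∈ apts, (isom A).Nonempty
  isom_injective : ∀ A ∈ apts, ∀ f ∈ isom A, Function.Injective f
  isom_range : ∀ A ∈ apts, ∀ f ∈ isom A, range f = A
  isom_iff : ∀ A ∈ apts, ∀ f₀ ∈ isom A, ∀ f : V → X,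
    f ∈ isom A ↔ ∃ w ∈ 𝔸.W, f = f₀ ∘ w

namespace ApartmentSystem

variable {𝔸 : Apartment V ι} {X : Type*} (S : ApartmentSystem 𝔸 X)

/-- A filter on `X` which, in some apartment, is an object of the kind `P`. -/
def IsOfKind (P : Filter V → Prop) (G : Filter X) : Prop :=
  ∃ A ∈ S.apts, ∃ f ∈ S.isom A, ∃ H, P H ∧ G = map f H

/-- For a filter `G` on `X` contained in the apartments `A` and `A'`: the intersection `A ∩ A'`
contains the enclosure of `G` computed in `A`, and there is an isomorphism from `A` onto `A'`
fixing (some element of) this enclosure. In terms of an isomorphism `f` from `V` onto `A`, an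
isomorphism from `A` onto `A'` is `f' ∘ f⁻¹` with `f' ∈ isom A'`. -/
def SharesEnclosure (A A' : Set X) (G : Filter X) : Prop :=
  ∀ f ∈ S.isom A, A ∩ A' ∈ map f (𝔸.cl (comap f G)) ∧
    ∃ f' ∈ S.isom A', ∀ᶠ v in 𝔸.cl (comap f G), f' v = f v

end ApartmentSystem

/-- Affine hovels (masures affines) of type `𝔸`. The fields `ma2`, `ma3`, `ma4` are the defining
axioms; `A ∈ G` means that the apartment `A` contains the filter `G`. -/
structure AffineHovel (𝔸 : Apartment V ι) (X : Type*) extends ApartmentSystem 𝔸 X where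
  ma2 : ∀ A ∈ apts, ∀ A' ∈ apts, ∀ f ∈ isom A, ∀ H : Filter V,
    (Apartment.IsPoint H ∨ 𝔸.IsPreorderedIntervalGerm H ∨ 𝔸.IsGenericHalfLine H ∨
      𝔸.IsSolidChimney H) →
    A' ∈ map f H → toApartmentSystem.SharesEnclosure A A' (map f H)
  ma3 : ∀ R G : Filter X, toApartmentSystem.IsOfKind 𝔸.IsSplayedChimneyGerm R →
    (toApartmentSystem.IsOfKind 𝔸.IsFacet G ∨
      toApartmentSystem.IsOfKind 𝔸.IsSolidChimneyGerm G) →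
    ∃ A ∈ apts, A ∈ R ∧ A ∈ G
  ma4 : ∀ R G : Filter X, toApartmentSystem.IsOfKind 𝔸.IsSplayedChimneyGerm R →
    (toApartmentSystem.IsOfKind 𝔸.IsFacet G ∨
      toApartmentSystem.IsOfKind 𝔸.IsSolidChimneyGerm G) →
    ∀ A ∈ apts, ∀ A' ∈ apts, A ∈ R → A ∈ G → A' ∈ R → A' ∈ G →
      toApartmentSystem.SharesEnclosure A A' (R ⊔ G)

/-! ### Spherical sector faces, parallelism, dominance and opposition -/

namespace AffineHovel

variable {𝔸 : Apartment V ι} {X : Type*} (S : AffineHovel 𝔸 X)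

/-- `f` is an isomorphism from `V` onto some apartment. -/
def IsChart (f : V → X) : Prop := ∃ A ∈ S.apts, f ∈ S.isom A

/-- The subset `s` of the hovel is, in the chart `f`, the spherical sector face `x + F`. -/
def Presents (s : Set X) (f : V → X) (x : V) (F : Set V) : Prop :=
  S.IsChart f ∧ 𝔸.IsSphericalVFacet F ∧ s = f '' (x +ᵥ F)

/-- The spherical sector faces of a hovel, as subsets. -/
def SphericalSectorFace : Type _ := {s : Set X // ∃ f x F, S.Presents s f x F}

variable {S}

namespace SphericalSectorFace

/-- The germ at infinity of a spherical sector face (every presentation gives the same one). -/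
def germ (s : S.SphericalSectorFace) : Filter X :=
  ⨅ (f : V → X) (x : V) (F : Set V) (_ : S.Presents s.1 f x F), map f (Apartment.sectorFaceGerm x F)

/-- The closure of a spherical sector face, in an apartment that contains it (every presentation
gives the same one). -/
def closure (s : S.SphericalSectorFace) : Set X :=
  ⋃ (f : V → X) (x : V) (F : Set V) (_ : S.Presents s.1 f x F), f '' (x +ᵥ _root_.closure F)

/-- `s` and `t` are parallel: in an apartment that contains both germs, these are germs of
sector faces `x + F` and `y + F`. -/
def Parallel (s t : S.SphericalSectorFace) : Prop :=
  ∃ f, S.IsChart f ∧ ∃ x y F, 𝔸.IsSphericalVFacet F ∧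
    s.germ = map f (Apartment.sectorFaceGerm x F) ∧ t.germ = map f (Apartment.sectorFaceGerm y F)

/-- `s` and `t` have opposite directions: in an apartment that contains both germs, these are
germs of sector faces `x + F` and `y - F`. -/
def Opposite (s t : S.SphericalSectorFace) : Prop :=
  ∃ f, S.IsChart f ∧ ∃ x y F, 𝔸.IsSphericalVFacet F ∧
    s.germ = map f (Apartment.sectorFaceGerm x F) ∧ t.germ = map f (Apartment.sectorFaceGerm y (-F))

/-- `s` dominates `t`: in an apartment that contains both germs, these are germs of sector faces
`x + F` and `y + F'` such that `F'` is contained in the closure of `F`. -/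
def Dominates (s t : S.SphericalSectorFace) : Prop :=
  ∃ f, S.IsChart f ∧ ∃ x y F F', 𝔸.IsSphericalVFacet F ∧ 𝔸.IsSphericalVFacet F' ∧
    F' ⊆ _root_.closure F ∧
    s.germ = map f (Apartment.sectorFaceGerm x F) ∧ t.germ = map f (Apartment.sectorFaceGerm y F')

end SphericalSectorFace

end AffineHovel

end Hovel

namespace Hovel

/-! ### Real roots and facets -/

namespace SimpleRoots

variable {V ι : Type*} [AddCommGroup V] [Module ℝ V] (D : SimpleRoots V ι)

/-! All three relations are read on the relative position of two germs: a pair of vectorial facets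
`(F, G)` giving their directions in one common apartment (`HasDirections`). Such a pair exists by
(MA3). By (MA4) it can be read in any apartment containing both germs, so it is unique up to the
vectorial Weyl group.

The heart is `Parallel.hasDirections`: the relative position of `s` and `u` does not change when `s`
is replaced by a parallel `t`, although no apartment need contain all three germs. In an apartment
containing the germs of `s` and `t`, the face is slid along a path. For a point `p` and a vectorial
facet `F₀`, (MA3) provides an apartment containing `u` at infinity and the germ of the chimney with
base `F(p, F₀)` and the direction of `s`. It also contains the germs of the faces based at `p + t •
v`, for `v ∈ F₀` and small `t > 0`. So the relative position is locally constant along a line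
directed by a facet, hence constant by connectedness. A single such line suffices
(`germ_invariant`), because a spherical facet is interior to plus or minus the Tits cone.

The axioms (MA3) and (MA4) speak of chimneys, not of sector faces. The bridge is
`IsEnclosed.mem_chimneyGerm`: by (MA2), an apartment containing the germ of `x + F` contains the
germ of the chimney of direction `F` based at the minimal facet of `x`. There may be infinitely many
roots; `eventually_nonneg` controls all of them at once.

Transitivity and the compatibilities then follow by computing with facets in one apartment. The
description of dominance by closures also needs `eq_of_parallel`, a parallel class has at most one
face from a given point; it is proved by the same sliding, with the facet of the point in place of a
chimney germ. -/

@[simp] theorem act_apply (w : V ≃ₗ[ℝ] V) (β : Module.Dual ℝ V) (v : V) :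
    act w β v = β (w.symm v) := rfl

theorem act_mul (w w' : V ≃ₗ[ℝ] V) (β : Module.Dual ℝ V) :
    act (w * w') β = act w (act w' β) := rfl

theorem refl_apply (i : ι) (v : V) : D.refl i v = v - D.root i v • D.coroot i :=
  Module.reflection_apply _ _

theorem refl_symm (i : ι) : (D.refl i).symm = D.refl i := Module.reflection_symm _

theorem refl_mem_Wv (i : ι) : D.refl i ∈ D.Wv := Subgroup.subset_closure ⟨i, rfl⟩

theorem parabolic_le_Wv (J : Set ι) : D.parabolic J ≤ D.Wv :=
  Subgroup.closure_mono (image_subset_range _ _)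

theorem act_refl_root (i : ι) : act (D.refl i) (D.root i) = -D.root i := by
  ext v
  rw [act_apply, refl_symm, refl_apply]
  simp only [map_sub, map_smul, D.root_coroot, smul_eq_mul, LinearMap.neg_apply]
  ring

theorem root_mem_realRoots (i : ι) : D.root i ∈ D.realRoots := ⟨1, one_mem _, i, rfl⟩

variable {D} in
theorem act_mem_realRoots {w : V ≃ₗ[ℝ] V} (hw : w ∈ D.Wv) {β : Module.Dual ℝ V}
    (hβ : β ∈ D.realRoots) : act w β ∈ D.realRoots := by
  obtain ⟨w', hw', i, rfl⟩ := hβ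
  exact ⟨w * w', mul_mem hw hw', i, (act_mul _ _ _).symm⟩

variable {D} in
theorem neg_mem_realRoots {β : Module.Dual ℝ V} (hβ : β ∈ D.realRoots) : -β ∈ D.realRoots := by
  obtain ⟨w, hw, i, rfl⟩ := hβ
  refine ⟨w * D.refl i, mul_mem hw (D.refl_mem_Wv i), i, ?_⟩
  rw [act_mul, act_refl_root]
  rfl

variable {D} in
theorem posCone_nonneg [Fintype ι] {β : Module.Dual ℝ V} (hβ : β ∈ D.posCone) {v : V}
    (hv : ∀ i, 0 ≤ D.root i v) : 0 ≤ β v := by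
  obtain ⟨c, hc, rfl⟩ := hβ
  simp only [LinearMap.sum_apply, LinearMap.smul_apply, smul_eq_mul]
  exact Finset.sum_nonneg fun i _ => mul_nonneg (hc i) (hv i)

theorem root_nonneg_of_mem_stdFacet {J : Set ι} {v : V} (hv : v ∈ D.stdFacet J) (i : ι) :
    0 ≤ D.root i v := by
  by_cases hi : i ∈ J
  · exact (hv.1 i hi).ge
  · exact (hv.2 i hi).le

variable {D} in
theorem posCone_eq_zero_of_mem_stdFacet [Fintype ι] {β : Module.Dual ℝ V} (hβ : β ∈ D.posCone)
    {J : Set ι} {v u : V} (hv : v ∈ D.stdFacet J) (hu : u ∈ D.stdFacet J) (h : β v = 0) :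
    β u = 0 := by
  obtain ⟨c, hc, rfl⟩ := hβ
  simp only [LinearMap.sum_apply, LinearMap.smul_apply, smul_eq_mul] at h ⊢
  rw [Finset.sum_eq_zero_iff_of_nonneg fun i _ =>
    mul_nonneg (hc i) (D.root_nonneg_of_mem_stdFacet hv i)] at h
  refine Finset.sum_eq_zero fun i hi => ?_
  by_cases hJ : i ∈ J
  · rw [hu.1 i hJ, mul_zero]
  · rcases mul_eq_zero.1 (h i hi) with h' | h'
    · rw [h', zero_mul]
    · exact absurd h' (hv.2 i hJ).ne'

theorem mem_image_stdFacet {w : V ≃ₗ[ℝ] V} {J : Set ι} {v : V} :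
    v ∈ w '' D.stdFacet J ↔ w.symm v ∈ D.stdFacet J :=
  ⟨by rintro ⟨u, hu, rfl⟩; simpa using hu, fun h => ⟨_, h, by simp⟩⟩

variable {D} in
theorem parabolic_fix {J : Set ι} {v : V} (hv : v ∈ D.stdFacet J) {w : V ≃ₗ[ℝ] V}
    (hw : w ∈ D.parabolic J) : w v = v := by
  induction hw using Subgroup.closure_induction with
  | mem x hx =>
    obtain ⟨i, hi, rfl⟩ := hx
    rw [refl_apply, hv.1 i hi, zero_smul, sub_zero]
  | one => rfl
  | mul x y _ _ hx hy => rw [LinearEquiv.mul_apply, hy, hx]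
  | inv x _ hx =>
    change x.symm v = v
    rw [LinearEquiv.symm_apply_eq, hx]

variable {D} in
theorem IsSphericalVFacet.isVFacet {F : Set V} (h : D.IsSphericalVFacet F) : D.IsVFacet F := by
  obtain ⟨w, hw, J, -, h⟩ := h
  exact ⟨w, hw, J, h⟩

variable {D} in
theorem IsSphericalVFacet.neg {F : Set V} (h : D.IsSphericalVFacet F) :
    D.IsSphericalVFacet (-F) := by
  obtain ⟨w, hw, J, hJ, rfl | rfl⟩ := h
  · exact ⟨w, hw, J, hJ, Or.inr rfl⟩
  · exact ⟨w, hw, J, hJ, Or.inl (neg_neg _)⟩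

variable {D} in
theorem IsSphericalVFacet.image {F : Set V} (h : D.IsSphericalVFacet F) {w : V ≃ₗ[ℝ] V}
    (hw : w ∈ D.Wv) : D.IsSphericalVFacet (w '' F) := by
  obtain ⟨w', hw', J, hJ, h⟩ := h
  refine ⟨w * w', mul_mem hw hw', J, hJ, ?_⟩
  have key : (w * w' : V ≃ₗ[ℝ] V) '' D.stdFacet J = w '' (w' '' D.stdFacet J) := by
    rw [image_image]; rfl
  rw [key]
  rcases h with rfl | rfl
  · exact Or.inl rfl
  · exact Or.inr (image_neg_of_apply_neg_eq_neg fun x _ => map_neg w x)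

theorem isVFacet_stdFacet (J : Set ι) : D.IsVFacet (D.stdFacet J) :=
  ⟨1, one_mem _, J, Or.inl (by simp)⟩

variable {D} in
theorem IsVFacet.neg {F : Set V} (h : D.IsVFacet F) : D.IsVFacet (-F) := by
  obtain ⟨w, hw, J, rfl | rfl⟩ := h
  · exact ⟨w, hw, J, Or.inr rfl⟩
  · exact ⟨w, hw, J, Or.inl (neg_neg _)⟩

variable {D} in
theorem IsVFacet.titsCone_or {F : Set V} (h : D.IsVFacet F) {v : V} (hv : v ∈ F) :
    v ∈ D.titsCone ∨ -v ∈ D.titsCone := by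
  obtain ⟨w, hw, J, rfl | rfl⟩ := h
  · exact Or.inl ⟨w, hw, J, hv⟩
  · exact Or.inr ⟨w, hw, J, hv⟩

end SimpleRoots

namespace Apartment

open SimpleRoots

variable {V ι : Type*} [NormedAddCommGroup V] [NormedSpace ℝ V] [Fintype ι]

section

variable {𝔸 : Apartment V ι}

theorem roots_sign {β : Module.Dual ℝ V} (hβ : β ∈ 𝔸.roots) :
    β ∈ 𝔸.posCone ∨ -β ∈ 𝔸.posCone :=
  hβ.elim (𝔸.root_sign β) (𝔸.imRoots_sign β)

theorem neg_mem_roots {β : Module.Dual ℝ V} (hβ : β ∈ 𝔸.roots) : -β ∈ 𝔸.roots :=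
  hβ.imp neg_mem_realRoots (𝔸.imRoots_neg β)

theorem act_mem_roots {w : V ≃ₗ[ℝ] V} (hw : w ∈ 𝔸.Wv) {β : Module.Dual ℝ V} (hβ : β ∈ 𝔸.roots) :
    act w β ∈ 𝔸.roots :=
  hβ.imp (act_mem_realRoots hw) (𝔸.imRoots_act w hw β)

/-- A facet is the image of a standard one by an isomorphism that preserves the real roots and the
signs of all roots up to a global change. -/
theorem exists_frame {F : Set V} (hF : 𝔸.IsVFacet F) :
    ∃ (g : V ≃ₗ[ℝ] V) (J : Set ι),
      (∀ β ∈ 𝔸.roots, act g.symm β ∈ 𝔸.posCone ∨ -act g.symm β ∈ 𝔸.posCone) ∧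
      (∀ i, act g (𝔸.root i) ∈ 𝔸.realRoots) ∧ ∀ v, v ∈ F ↔ g.symm v ∈ 𝔸.stdFacet J := by
  obtain ⟨w, hw, J, rfl | rfl⟩ := hF
  · exact ⟨w, J, fun β hβ => roots_sign (act_mem_roots (inv_mem hw) hβ),
      fun i => ⟨w, hw, i, rfl⟩, fun v => mem_image_stdFacet _⟩
  · refine ⟨w.trans (LinearEquiv.neg ℝ), J, fun β hβ => ?_, fun i => ?_, fun v => ?_⟩
    · have h : act (w.trans (LinearEquiv.neg ℝ)).symm β = act w.symm (-β) := by
        ext v; simp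
      rw [h]
      exact roots_sign (act_mem_roots (inv_mem hw) (neg_mem_roots hβ))
    · have h : act (w.trans (LinearEquiv.neg ℝ)) (𝔸.root i) = -act w (𝔸.root i) := by
        ext v; simp [LinearEquiv.symm_neg]
      rw [h]
      exact neg_mem_realRoots ⟨w, hw, i, rfl⟩
    · rw [Set.mem_neg, mem_image_stdFacet]
      simp [LinearEquiv.symm_neg]

theorem facet_smul {F : Set V} (hF : 𝔸.IsVFacet F) {v : V} (hv : v ∈ F) {t : ℝ}
    (ht : 0 < t) : t • v ∈ F := by
  obtain ⟨g, J, -, -, h⟩ := exists_frame hF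
  rw [h] at hv ⊢
  refine ⟨fun i hi => ?_, fun i hi => ?_⟩
  · rw [map_smul, map_smul, hv.1 i hi, smul_zero]
  · rw [map_smul, map_smul]
    exact mul_pos ht (hv.2 i hi)

theorem facet_smul_closure {F : Set V} (hF : 𝔸.IsVFacet F) {v : V} (hv : v ∈ closure F)
    {t : ℝ} (ht : 0 < t) :
    t • v ∈ closure F :=
  map_mem_closure (continuous_const_smul t) hv fun _ hx => facet_smul hF hx ht

/-- These are the asymptotic directions of a closed cone: divide by `t` and let `t` tend to
infinity. -/
theorem mem_closure_facet_of_add_smul {F : Set V} (hF : 𝔸.IsVFacet F) {a v : V}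
    (h : ∀ t : ℝ, 0 < t → a + t • v ∈ closure F) :
    v ∈ closure F := by
  have h1 : Tendsto (fun t : ℝ => t⁻¹ • a + v) atTop (𝓝 ((0 : ℝ) • a + v)) :=
    (tendsto_inv_atTop_zero.smul_const a).add_const v
  rw [zero_smul, zero_add] at h1
  refine isClosed_closure.mem_of_tendsto h1 ?_
  filter_upwards [eventually_gt_atTop 0] with t ht
  have := facet_smul_closure hF (h t ht) (inv_pos.2 ht)
  rwa [smul_add, smul_smul, inv_mul_cancel₀ ht.ne', one_smul] at this

/-- Induction on the length. If `i` is a right descent of `w`, the root `w (α i)` is negative;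
evaluating it at `v = w v` gives `α i v = 0`. Hence `i ∈ J`, and `w r_i` is a shorter element fixing
`v`. -/
theorem mem_parabolic_of_fix {J : Set ι} {v : V} (hv : v ∈ 𝔸.stdFacet J) {w : V ≃ₗ[ℝ] V}
    (hw : w ∈ 𝔸.Wv) (h : w v = v) : w ∈ 𝔸.parabolic J := by
  obtain ⟨M, cs, hs, hl⟩ := 𝔸.coxeter
  suffices H : ∀ n (w : 𝔸.Wv), cs.length w = n → (w : V ≃ₗ[ℝ] V) v = v →
      (w : V ≃ₗ[ℝ] V) ∈ 𝔸.parabolic J from H _ ⟨w, hw⟩ rfl h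
  intro n
  induction n using Nat.strong_induction_on with
  | _ n ih =>
    intro w hn h
    by_cases h1 : w = 1
    · rw [h1]; exact one_mem _
    obtain ⟨i, hi⟩ := cs.exists_rightDescent_of_ne_one h1
    have hi' : cs.length (w * cs.simple i) < cs.length w := hi
    have hneg := (𝔸.root_sign _ ⟨w, w.2, i, rfl⟩).resolve_left fun h' =>
      lt_asymm hi' ((hl w i).1 h')
    have h2 := posCone_nonneg hneg (𝔸.root_nonneg_of_mem_stdFacet hv)
    have h3 : (w : V ≃ₗ[ℝ] V).symm v = v := by rw [LinearEquiv.symm_apply_eq, h]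
    rw [LinearMap.neg_apply, act_apply, h3] at h2
    have h4 : 𝔸.root i v = 0 :=
      le_antisymm (by linarith) (𝔸.root_nonneg_of_mem_stdFacet hv i)
    have hJ : i ∈ J := by
      by_contra hJ
      exact (hv.2 i hJ).ne' h4
    have h5 := ih _ (hn ▸ hi') (w * cs.simple i) rfl (by
      rw [Subgroup.coe_mul, LinearEquiv.mul_apply, hs, refl_apply, h4, zero_smul, sub_zero, h])
    have h6 : 𝔸.refl i ∈ 𝔸.parabolic J := Subgroup.subset_closure ⟨i, hJ, rfl⟩
    rw [Subgroup.coe_mul, hs] at h5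
    exact (Subgroup.mul_mem_cancel_right _ h6).1 h5

end

variable [FiniteDimensional ℝ V] (𝔸 : Apartment V ι)

/-- A family of vectors dual to the simple roots. -/
theorem exists_coweights [DecidableEq ι] :
    ∃ ω : ι → V, ∀ i j, 𝔸.root i (ω j) = if i = j then 1 else 0 := by
  -- The coordinates with respect to the simple roots extend to linear forms on the dual of `V`, and
  -- these are evaluations at vectors since `V` is finite-dimensional.
  obtain ⟨L, hL⟩ := LinearMap.exists_extend 𝔸.linearIndependent_root.repr
  refine ⟨fun j => (Module.evalEquiv ℝ V).symm (Finsupp.lapply j ∘ₗ L), fun i j => ?_⟩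
  rw [Module.apply_evalEquiv_symm_apply]
  have h := LinearMap.congr_fun hL ⟨𝔸.root i, Submodule.subset_span ⟨i, rfl⟩⟩
  have h2 := 𝔸.linearIndependent_root.repr_eq_single i
    ⟨𝔸.root i, Submodule.subset_span ⟨i, rfl⟩⟩ rfl
  simp only [LinearMap.comp_apply, Submodule.subtype_apply] at h
  simp only [LinearMap.comp_apply, Finsupp.lapply_apply]
  rw [h]
  erw [h2]
  simp [Finsupp.single_apply]

theorem stdFacet_nonempty (J : Set ι) : (𝔸.stdFacet J).Nonempty := by
  classical
  obtain ⟨ω, hω⟩ := 𝔸.exists_coweights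
  have h (i : ι) : 𝔸.root i (∑ j, (if j ∈ J then (0 : ℝ) else 1) • ω j) =
      if i ∈ J then 0 else 1 := by
    simp only [map_sum, map_smul, hω, smul_eq_mul, mul_ite, mul_one, mul_zero,
      Finset.sum_ite_eq, Finset.mem_univ, if_true]
  exact ⟨_, fun i hi => by rw [h, if_pos hi], fun i hi => by rw [h, if_neg hi]; exact one_pos⟩

variable {𝔸}

theorem facet_closure_subset_frame {F : Set V} {g : V ≃ₗ[ℝ] V} {J : Set ι}
    (h : ∀ v, v ∈ F ↔ g.symm v ∈ 𝔸.stdFacet J) {v : V} (hv : v ∈ closure F) :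
    (∀ i ∈ J, 𝔸.root i (g.symm v) = 0) ∧ ∀ i, 0 ≤ 𝔸.root i (g.symm v) := by
  have hc (i : ι) : Continuous fun v => 𝔸.root i (g.symm v) :=
    (𝔸.root i ∘ₗ g.symm.toLinearMap).continuous_of_finiteDimensional
  refine ⟨fun i hi => ?_, fun i => ?_⟩
  · exact closure_minimal (t := {v | 𝔸.root i (g.symm v) = 0})
      (fun u hu => ((h u).1 hu).1 i hi) (isClosed_eq (hc i) continuous_const) hv
  · exact closure_minimal (t := {v | 0 ≤ 𝔸.root i (g.symm v)})
      (fun u hu => 𝔸.root_nonneg_of_mem_stdFacet ((h u).1 hu) i)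
      (isClosed_le continuous_const (hc i)) hv

/-! ### Facets as convex cones, and the signs of roots on them -/

section Facet

variable {F : Set V} (hF : 𝔸.IsVFacet F)
include hF

theorem facet_nonempty : F.Nonempty := by
  obtain ⟨g, J, -, -, h⟩ := exists_frame hF
  obtain ⟨v, hv⟩ := 𝔸.stdFacet_nonempty J
  exact ⟨g v, (h _).2 (by simpa using hv)⟩

theorem facet_closure_add {v u : V} (hv : v ∈ closure F) (hu : u ∈ F) : v + u ∈ F := by
  obtain ⟨g, J, -, -, h⟩ := exists_frame hF
  obtain ⟨h1, h2⟩ := facet_closure_subset_frame h hv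
  rw [h] at hu ⊢
  refine ⟨fun i hi => ?_, fun i hi => ?_⟩
  · rw [map_add, map_add, h1 i hi, hu.1 i hi, add_zero]
  · rw [map_add, map_add]
    exact add_pos_of_nonneg_of_pos (h2 i) (hu.2 i hi)

theorem zero_mem_closure_facet : (0 : V) ∈ closure F := by
  obtain ⟨v, hv⟩ := facet_nonempty hF
  have h1 : Tendsto (fun t : ℝ => t⁻¹ • v) atTop (𝓝 ((0 : ℝ) • v)) :=
    tendsto_inv_atTop_zero.smul_const v
  rw [zero_smul] at h1
  refine mem_closure_of_tendsto h1 ?_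
  filter_upwards [eventually_gt_atTop 0] with t ht
  exact facet_smul hF hv (inv_pos.2 ht)

theorem facet_closure_add_closure {v u : V} (hv : v ∈ closure F) (hu : u ∈ closure F) :
    v + u ∈ closure F :=
  map_mem_closure (continuous_const.add continuous_id) hu fun _ hx => facet_closure_add hF hv hx

/-- In the frame of `F` a root is a combination of simple roots with coefficients of one sign. If
the coefficients are nonpositive, nonnegativity at one point of the facet forces every term to
vanish there, hence on the whole facet. -/
theorem root_nonneg_facet {β : Module.Dual ℝ V} (hβ : β ∈ 𝔸.roots) {v u : V} (hv : v ∈ F)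
    (hu : u ∈ closure F) (h : 0 ≤ β v) : 0 ≤ β u := by
  refine closure_minimal (t := {u | 0 ≤ β u}) (fun u hu => ?_)
    (isClosed_le continuous_const β.continuous_of_finiteDimensional) hu
  obtain ⟨g, J, hs, -, hg⟩ := exists_frame hF
  rw [hg] at hv hu
  have e (x : V) : β x = act g.symm β (g.symm x) := by simp
  rw [mem_ofPred_eq, e]
  rw [e] at h
  rcases hs β hβ with h' | h'
  · exact posCone_nonneg h' (𝔸.root_nonneg_of_mem_stdFacet hu)
  · have h0 := posCone_nonneg h' (𝔸.root_nonneg_of_mem_stdFacet hv)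
    have h1 := posCone_eq_zero_of_mem_stdFacet h' hv hu
      (le_antisymm (by rw [LinearMap.neg_apply]; linarith) h0)
    rw [LinearMap.neg_apply] at h1
    linarith

theorem root_eq_zero_facet {β : Module.Dual ℝ V} (hβ : β ∈ 𝔸.roots) {v u : V} (hv : v ∈ F)
    (hu : u ∈ closure F) (h : β v = 0) : β u = 0 := by
  have h1 := root_nonneg_facet hF hβ hv hu h.ge
  have h2 := root_nonneg_facet hF (neg_mem_roots hβ) hv hu (by simp [h])
  rw [LinearMap.neg_apply] at h2
  linarith

/-- If a root defining a boundary face of `G` vanished at a point of `F`, it would vanish on the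
closure of `F`, hence on `G`. -/
theorem facet_subset_of_subset_closure {G : Set V} (hG : 𝔸.IsVFacet G) (h1 : F ⊆ closure G)
    (h2 : G ⊆ closure F) : F ⊆ G := by
  intro v hv
  obtain ⟨g, J, -, hr, hg⟩ := exists_frame hG
  obtain ⟨u, hu⟩ := facet_nonempty hG
  obtain ⟨h3, h4⟩ := facet_closure_subset_frame hg (h1 hv)
  rw [hg]
  refine ⟨h3, fun i hi => (h4 i).lt_of_ne fun h => ?_⟩
  have h5 := root_eq_zero_facet hF (Or.inl (hr i)) hv (h2 hu) h.symm
  exact (((hg u).1 hu).2 i hi).ne' h5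

theorem facet_eq_of_subset_closure {G : Set V} (hG : 𝔸.IsVFacet G) (h1 : F ⊆ closure G)
    (h2 : G ⊆ closure F) : F = G :=
  (facet_subset_of_subset_closure hF hG h1 h2).antisymm
    (facet_subset_of_subset_closure hG hF h2 h1)

end Facet

/-! ### Spherical facets -/

/-- A conjugate of the fixer lies in the finite parabolic subgroup of the type of `F`. -/
theorem fixer_finite {F : Set V} (hF : 𝔸.IsSphericalVFacet F) :
    {w : V ≃ₗ[ℝ] V | w ∈ 𝔸.Wv ∧ ∀ v ∈ F, w v = v}.Finite := by
  obtain ⟨w, hw, J, hJ, hF'⟩ := hF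
  have key : ∀ u ∈ 𝔸.Wv, (∀ v ∈ F, u v = v) → ∀ v ∈ 𝔸.stdFacet J, u (w v) = w v := by
    intro u _ h v hv
    rcases hF' with rfl | rfl
    · exact h _ ⟨v, hv, rfl⟩
    · have := h (-w v) (by rw [Set.mem_neg, neg_neg]; exact ⟨v, hv, rfl⟩)
      rwa [map_neg, neg_inj] at this
  refine (hJ.image fun u => w * u * w⁻¹).subset ?_
  rintro u ⟨hu, h⟩
  obtain ⟨v, hv⟩ := 𝔸.stdFacet_nonempty J
  refine ⟨w⁻¹ * u * w, mem_parabolic_of_fix hv (mul_mem (mul_mem (inv_mem hw) hu) hw) ?_, by group⟩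
  rw [LinearEquiv.mul_apply, LinearEquiv.mul_apply, key u hu h v hv]
  exact w.symm_apply_apply v

/-- A vector is moved into the closed fundamental chamber of a finite standard parabolic subgroup by
some element of it. -/
theorem exists_parabolic_nonneg {J : Set ι} (hJ : (𝔸.parabolic J : Set (V ≃ₗ[ℝ] V)).Finite)
    (u : V) : ∃ w ∈ 𝔸.parabolic J, ∀ j ∈ J, 0 ≤ 𝔸.root j (w u) := by
  classical
  let b := Module.finBasis ℝ V
  let P := hJ.toFinset
  have hP {w : V ≃ₗ[ℝ] V} : w ∈ P ↔ w ∈ 𝔸.parabolic J := hJ.mem_toFinset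
  -- Averaging a scalar product over the finite group gives an invariant positive definite form.
  let B : V → V → ℝ := fun x y => ∑ w ∈ P, ∑ k, b.repr (w x) k * b.repr (w y) k
  have hinv (r : V ≃ₗ[ℝ] V) (hr : r ∈ 𝔸.parabolic J) (x y : V) : B (r x) (r y) = B x y := by
    refine Finset.sum_nbij' (fun w => w * r) (fun w => w * r⁻¹) ?_ ?_ ?_ ?_ ?_
    · exact fun w hw => hP.2 (mul_mem (hP.1 hw) hr)
    · exact fun w hw => hP.2 (mul_mem (hP.1 hw) (inv_mem hr))
    · exact fun w _ => by group
    · exact fun w _ => by group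
    · exact fun w _ => rfl
  have hadd (x y z : V) : B (x + y) z = B x z + B y z := by
    simp only [B, map_add, Finsupp.add_apply, add_mul, Finset.sum_add_distrib]
  have hsmul (t : ℝ) (x z : V) : B (t • x) z = t * B x z := by
    simp only [B, map_smul, Finsupp.smul_apply, smul_eq_mul, mul_assoc, Finset.mul_sum]
  have hcomm (x y : V) : B x y = B y x := by
    simp only [B, mul_comm]
  have hpos (x : V) (hx : x ≠ 0) : 0 < B x x := by
    refine Finset.sum_pos (fun w _ => ?_) ⟨1, hP.2 (one_mem _)⟩
    have hne : b.repr (w x) ≠ 0 := by simpa using hx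
    obtain ⟨k, hk⟩ := Finsupp.ne_iff.1 hne
    exact Finset.sum_pos' (fun k _ => mul_self_nonneg _)
      ⟨k, Finset.mem_univ _, mul_self_pos.2 hk⟩
  obtain ⟨c, hc⟩ := 𝔸.stdFacet_nonempty ∅
  -- The translate of `u` with the largest product with a vector `c` of the open chamber is the
  -- wanted one, since no reflection can increase this product.
  obtain ⟨w, hw, hmax⟩ := P.exists_max_image (fun w => B (w u) c) ⟨1, hP.2 (one_mem _)⟩
  refine ⟨w, hP.1 hw, fun j hj => ?_⟩
  have hr : 𝔸.refl j ∈ 𝔸.parabolic J := Subgroup.subset_closure ⟨j, hj, rfl⟩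
  set a := 𝔸.coroot j
  have ha : 𝔸.root j a = 2 := 𝔸.root_coroot j
  have ha0 : a ≠ 0 := by rintro h; rw [h, map_zero] at ha; norm_num at ha
  -- Invariance under `r_j` gives `2 B(a, c) = α j (c) B(a, a)`.
  have h1 : 0 < B a c := by
    have h := hinv _ hr a c
    have e1 : 𝔸.refl j a = (-1 : ℝ) • a := by
      rw [refl_apply, ha]; module
    have e2 : 𝔸.refl j c = c + (-𝔸.root j c) • a := by
      rw [refl_apply]; module
    rw [e1, e2, hsmul, hcomm, hadd, hsmul, hcomm c a] at h
    have h3 : 0 < 𝔸.root j c := hc.2 j (notMem_empty j)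
    nlinarith [mul_pos h3 (hpos a ha0)]
  have h2 := hmax (𝔸.refl j * w) (hP.2 (mul_mem hr (hP.1 hw)))
  simp only [LinearEquiv.mul_apply] at h2
  have e3 : 𝔸.refl j (w u) = w u + (-𝔸.root j (w u)) • a := by
    rw [refl_apply]; module
  rw [e3, hadd, hsmul] at h2
  by_contra h
  push Not at h
  nlinarith [mul_pos (neg_pos.2 h) h1]

/-- Near a vector `ζ` of a spherical facet there are only vectors of plus or minus the Tits cone, on
which the roots positive at `ζ` are nonnegative. -/
theorem eventually_nonneg {F : Set V} (hF : 𝔸.IsSphericalVFacet F) {ζ : V} (hζ : ζ ∈ F) :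
    ∀ᶠ u in 𝓝 ζ, (∃ F₀, 𝔸.IsVFacet F₀ ∧ u ∈ F₀) ∧ ∀ β ∈ 𝔸.roots, 0 < β ζ → 0 ≤ β u := by
  have std : ∀ J : Set ι, (𝔸.parabolic J : Set (V ≃ₗ[ℝ] V)).Finite → ∀ ζ ∈ 𝔸.stdFacet J,
      ∀ᶠ u in 𝓝 ζ, ∃ w ∈ 𝔸.Wv, (∀ i, 0 ≤ 𝔸.root i (w u)) ∧ ∀ β ∈ 𝔸.roots, 0 < β ζ → 0 ≤ β u := by
    intro J hJ ζ hζ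
    -- The finite group fixes `ζ`, so these are finitely many open conditions that hold at `ζ`.
    have h1 : ∀ᶠ u in 𝓝 ζ, ∀ w ∈ (𝔸.parabolic J : Set (V ≃ₗ[ℝ] V)), ∀ i ∉ J,
        0 < 𝔸.root i (w u) := by
      rw [hJ.eventually_all]
      intro w hw
      rw [eventually_all]
      intro i
      by_cases hi : i ∈ J
      · exact Eventually.of_forall fun u h => absurd hi h
      · have hc : Continuous fun u => 𝔸.root i (w u) :=
          (𝔸.root i ∘ₗ w.toLinearMap).continuous_of_finiteDimensional
        have h0 : 0 < 𝔸.root i (w ζ) := by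
          rw [parabolic_fix hζ hw]
          exact hζ.2 i hi
        filter_upwards [(hc.tendsto ζ).eventually_const_lt h0] with u hu _ using hu
    filter_upwards [h1] with u hu
    obtain ⟨w, hw, hwu⟩ := exists_parabolic_nonneg hJ u
    have hnn : ∀ i, 0 ≤ 𝔸.root i (w u) := fun i => by
      by_cases hi : i ∈ J
      · exact hwu i hi
      · exact (hu w hw i hi).le
    refine ⟨w, 𝔸.parabolic_le_Wv J hw, hnn, fun β hβ hpos => ?_⟩
    have hroot := act_mem_roots (𝔸.parabolic_le_Wv J hw) hβ
    have hfix : w.symm ζ = ζ := by rw [LinearEquiv.symm_apply_eq, parabolic_fix hζ hw]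
    -- As `w` fixes `ζ`, the root `w β` is positive at `ζ`, hence lies in the positive cone. One
    -- neighbourhood thus serves for all roots, even infinitely many.
    have h2 : act w β ∈ 𝔸.posCone := (roots_sign hroot).resolve_right fun h => by
      have h3 := posCone_nonneg h (𝔸.root_nonneg_of_mem_stdFacet hζ)
      rw [LinearMap.neg_apply, act_apply, hfix] at h3
      linarith
    have h4 := posCone_nonneg h2 hnn
    rwa [act_apply, w.symm_apply_apply] at h4
  have pos : ∀ (w : V ≃ₗ[ℝ] V), w ∈ 𝔸.Wv → ∀ J : Set ι,
      (𝔸.parabolic J : Set (V ≃ₗ[ℝ] V)).Finite → ∀ ζ ∈ w '' 𝔸.stdFacet J,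
      ∀ᶠ u in 𝓝 ζ, (∃ F₀, 𝔸.IsVFacet F₀ ∧ u ∈ F₀) ∧
        ∀ β ∈ 𝔸.roots, 0 < β ζ → 0 ≤ β u := by
    rintro w hw J hJ _ ⟨ζ, hζ, rfl⟩
    have hc : Tendsto w.symm (𝓝 (w ζ)) (𝓝 ζ) := by
      have := (w.symm.toLinearMap.continuous_of_finiteDimensional).tendsto (w ζ)
      simpa using this
    filter_upwards [hc.eventually (std J hJ ζ hζ)] with u hu
    obtain ⟨w', hw', hnn, hβ⟩ := hu
    refine ⟨⟨(w * w'⁻¹ : V ≃ₗ[ℝ] V) '' 𝔸.stdFacet {i | 𝔸.root i (w' (w.symm u)) = 0},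
      ⟨_, mul_mem hw (inv_mem hw'), _, Or.inl rfl⟩, ⟨w' (w.symm u), ⟨fun i hi => hi, fun i hi =>
        (hnn i).lt_of_ne (Ne.symm hi)⟩, ?_⟩⟩, fun β hβ' hpos => ?_⟩
    · rw [LinearEquiv.mul_apply]
      change w (w'.symm (w' (w.symm u))) = u
      simp
    · have := hβ (act w.symm β) (act_mem_roots (inv_mem hw) hβ') (by simpa using hpos)
      simpa using this
  obtain ⟨w, hw, J, hJ, rfl | rfl⟩ := hF
  · exact pos w hw J hJ ζ hζ
  · have h := (continuous_neg.tendsto ζ).eventually (pos w hw J hJ (-ζ) hζ)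
    filter_upwards [h] with u hu
    obtain ⟨⟨F₀, hF₀, hu₀⟩, hβ⟩ := hu
    refine ⟨⟨-F₀, hF₀.neg, hu₀⟩, fun β hβ' hpos => ?_⟩
    have := hβ (-β) (neg_mem_roots hβ') (by simpa using hpos)
    simpa using this

end Apartment

end Hovel

namespace Hovel

namespace Apartment

open SimpleRoots

section

variable {V ι : Type*} [NormedAddCommGroup V] [NormedSpace ℝ V] [Fintype ι] {𝔸 : Apartment V ι}

/-! ### The affine Weyl group and the walls -/

theorem linear_mem_Wv {g : V ≃ᵃ[ℝ] V} (hg : g ∈ 𝔸.W) : g.linear ∈ 𝔸.Wv := by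
  suffices H : 𝔸.W ≤ 𝔸.Wv.comap AffineEquiv.linearHom from H hg
  refine (Subgroup.closure_le _).2 ?_
  rintro g ⟨w, hw, i, k, -, h⟩
  change g.linear ∈ 𝔸.Wv
  have : g.linear = w * 𝔸.refl i * w⁻¹ := by
    ext v
    have h1 : g.linear v = g v - g 0 := by
      have := g.map_vadd 0 v
      simp only [vadd_eq_add, add_zero] at this
      rw [this, add_sub_cancel_right]
    rw [h1, h, h]
    change _ = w (𝔸.refl i (w.symm v))
    rw [refl_apply]
    simp only [map_sub, map_smul, LinearEquiv.apply_symm_apply, act_apply, map_zero]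
    module
  rw [this]
  exact mul_mem (mul_mem hw (𝔸.refl_mem_Wv i)) (inv_mem hw)

theorem affineEquiv_image_vadd (g : V ≃ᵃ[ℝ] V) (x : V) (F : Set V) :
    g '' (x +ᵥ F) = g x +ᵥ g.linear '' F := by
  ext v
  simp only [mem_image, mem_vadd_set, vadd_eq_add]
  constructor
  · rintro ⟨_, ⟨u, hu, rfl⟩, rfl⟩
    refine ⟨_, ⟨u, hu, rfl⟩, ?_⟩
    have := g.map_vadd x u
    simp only [vadd_eq_add] at this
    rw [add_comm x u, this, add_comm]
  · rintro ⟨_, ⟨u, hu, rfl⟩, rfl⟩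
    refine ⟨_, ⟨u, hu, rfl⟩, ?_⟩
    have := g.map_vadd x u
    simp only [vadd_eq_add] at this
    rw [add_comm x u, this, add_comm]

/-- The reflection in a wall belongs to the affine Weyl group. -/
theorem exists_reflection {w : V ≃ₗ[ℝ] V} (hw : w ∈ 𝔸.Wv) (i : ι) {k : ℝ}
    (hk : hyperplane (act w (𝔸.root i)) k ∈ 𝔸.walls) :
    ∃ g ∈ 𝔸.W, ∀ v, g v = v - (act w (𝔸.root i) v + k) • w (𝔸.coroot i) := by
  have h2 : act w (𝔸.root i) (w (𝔸.coroot i)) = 2 := by simp [𝔸.root_coroot]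
  let L := Module.reflection h2
  let g : V ≃ᵃ[ℝ] V := L.toAffineEquiv.trans (AffineEquiv.constVAdd ℝ V (-(k • w (𝔸.coroot i))))
  have hg (v : V) : g v = v - (act w (𝔸.root i) v + k) • w (𝔸.coroot i) := by
    change -(k • w (𝔸.coroot i)) + L v = _
    rw [Module.reflection_apply]
    module
  exact ⟨g, Subgroup.subset_closure ⟨w, hw, i, k, hk, hg⟩, hg⟩

theorem reflect_level {β : Module.Dual ℝ V} (hβ : β ∈ 𝔸.realRoots) {k l : ℝ}
    (hk : hyperplane β k ∈ 𝔸.walls) (hl : hyperplane β l ∈ 𝔸.walls) :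
    hyperplane β (2 * k - l) ∈ 𝔸.walls := by
  obtain ⟨w, hw, i, rfl⟩ := hβ
  obtain ⟨g, hg, h⟩ := exists_reflection hw i hk
  have h2 : act w (𝔸.root i) (w (𝔸.coroot i)) = 2 := by simp [𝔸.root_coroot]
  have h3 (v : V) : act w (𝔸.root i) (g v) = -act w (𝔸.root i) v - 2 * k := by
    rw [h, map_sub, map_smul, h2, smul_eq_mul]; ring
  have h4 (v : V) : g (g v) = v := by
    rw [h (g v), h3, h v]; module
  convert 𝔸.walls_stable g hg _ hl using 1
  ext v
  constructor
  · intro hv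
    refine ⟨g v, ?_, h4 v⟩
    simp only [hyperplane, mem_ofPred_eq, h3] at hv ⊢
    linarith
  · rintro ⟨u, hu, rfl⟩
    simp only [hyperplane, mem_ofPred_eq, h3] at hu ⊢
    linarith

/-- Two distinct parallel walls suffice: composing the reflections in the levels `a` and `b` shifts
levels by `2 (b - a)`, which yields an arithmetic progression of walls. -/
theorem exists_level_ge {β : Module.Dual ℝ V} (hβ : β ∈ 𝔸.realRoots) (c : ℝ) :
    ∃ k, c ≤ k ∧ hyperplane β k ∈ 𝔸.walls := by
  obtain ⟨a, ha, b, hb, hab⟩ := (𝔸.walls_infinite β hβ).nontrivial.exists_lt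
  have hn (n : ℕ) : hyperplane β (a + n * (2 * (b - a))) ∈ 𝔸.walls := by
    induction n with
    | zero => simpa using ha
    | succ n ih =>
      convert reflect_level hβ hb (reflect_level hβ ha ih) using 2
      push_cast
      ring
  obtain ⟨n, hn'⟩ := exists_nat_ge ((c - a) / (2 * (b - a)))
  refine ⟨_, ?_, hn n⟩
  rw [div_le_iff₀ (by linarith)] at hn'
  linarith

theorem root_stdFacet_univ {β : Module.Dual ℝ V} (hβ : β ∈ 𝔸.roots) {v : V}
    (hv : v ∈ 𝔸.stdFacet univ) : β v = 0 := by
  have key {γ : Module.Dual ℝ V} (h : γ ∈ 𝔸.posCone) : γ v = 0 := by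
    obtain ⟨c, -, rfl⟩ := h
    simp only [LinearMap.sum_apply, LinearMap.smul_apply, hv.1 _ (mem_univ _), smul_zero,
      Finset.sum_const_zero]
  rcases roots_sign hβ with h | h
  · exact key h
  · simpa using key h

theorem zero_mem_stdFacet_univ : (0 : V) ∈ 𝔸.stdFacet univ :=
  ⟨fun _ _ => map_zero _, fun _ hi => (hi (mem_univ _)).elim⟩

theorem subset_closure_of_vadd_subset {F G : Set V} (hF : 𝔸.IsVFacet F) (hG : 𝔸.IsVFacet G)
    {x y : V} (h : y +ᵥ G ⊆ x +ᵥ closure F) : G ⊆ closure F := by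
  intro u hu
  refine mem_closure_facet_of_add_smul hF (a := y - x) fun t ht => ?_
  obtain ⟨c, hc, he⟩ := h ⟨t • u, facet_smul hG hu ht, rfl⟩
  simp only [vadd_eq_add] at he
  have : y - x + t • u = c := by rw [sub_add_eq_add_sub, ← he, add_sub_cancel_left]
  rwa [this]

/-! ### Enclosed sets -/

theorem mem_halfSpace_coe {β : Module.Dual ℝ V} {r : ℝ} {v : V} :
    v ∈ halfSpace β (r : WithTop ℝ) ↔ 0 ≤ β v + r := by
  simp only [halfSpace, mem_ofPred_eq, WithTop.coe_le_coe]
  constructor <;> intro h <;> linarith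

theorem mem_halfSpace_top {β : Module.Dual ℝ V} {v : V} : v ∈ halfSpace β ⊤ := by
  simp [halfSpace]

theorem IsEnclosed.isSemiEnclosed {Q : Set V} (hQ : 𝔸.IsEnclosed Q) : 𝔸.IsSemiEnclosed Q := by
  obtain ⟨k, hk, rfl⟩ := hQ
  exact ⟨k, ∅, hk, by simp⟩

theorem isEnclosed_of_forall {k : Module.Dual ℝ V → WithTop ℝ}
    (hk : ∀ β ∈ 𝔸.roots, k β ∈ 𝔸.levels β) :
    𝔸.IsEnclosed {v | ∀ β ∈ 𝔸.roots, v ∈ halfSpace β (k β)} :=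
  ⟨k, hk, by ext v; simp⟩

/-- An enclosed set, as the set of solutions of a family of inequations. -/
theorem IsEnclosed.exists_levels {Q : Set V} (hQ : 𝔸.IsEnclosed Q) :
    ∃ k : Module.Dual ℝ V → WithTop ℝ, (∀ β ∈ 𝔸.roots, k β ∈ 𝔸.levels β) ∧
      ∀ v, v ∈ Q ↔ ∀ β ∈ 𝔸.roots, ∀ r : ℝ, k β = r → 0 ≤ β v + r := by
  obtain ⟨k, hk, rfl⟩ := hQ
  refine ⟨k, hk, fun v => ?_⟩
  simp only [mem_iInter]
  refine forall_congr' fun β => forall_congr' fun _ => ?_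
  induction k β with
  | top => exact iff_of_true mem_halfSpace_top fun r hr => (WithTop.top_ne_coe hr).elim
  | coe r =>
    constructor
    · intro h r' hr
      obtain rfl := WithTop.coe_injective hr
      exact mem_halfSpace_coe.1 h
    · intro h
      exact mem_halfSpace_coe.2 (h r rfl)

theorem isSplayedChimneyGerm {F₀ F : Set V} (hF₀ : 𝔸.IsVFacet F₀) (hF : 𝔸.IsSphericalVFacet F)
    (x : V) : 𝔸.IsSplayedChimneyGerm (𝔸.chimneyGerm x F₀ F) :=
  ⟨x, F₀, F, hF₀, hF, rfl⟩

variable (𝔸) in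
/-- Every point `x` lies in an enclosed set on which the simple roots are bounded. -/
theorem exists_isEnclosed_bounded (x : V) :
    ∃ Q, 𝔸.IsEnclosed Q ∧ x ∈ Q ∧ ∃ C : ℝ, ∀ v ∈ Q, ∀ i, |𝔸.root i (v - x)| ≤ C := by
  classical
  have hex : ∀ β : Module.Dual ℝ V, ∃ k : ℝ, β ∈ 𝔸.realRoots →
      -β x ≤ k ∧ hyperplane β k ∈ 𝔸.walls := by
    intro β
    by_cases hβ : β ∈ 𝔸.realRoots
    · obtain ⟨k, hk⟩ := exists_level_ge hβ (-β x)
      exact ⟨k, fun _ => hk⟩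
    · exact ⟨0, fun h => absurd h hβ⟩
  choose c hc using hex
  let k : Module.Dual ℝ V → WithTop ℝ := fun β => if β ∈ 𝔸.realRoots then (c β : WithTop ℝ) else ⊤
  have hk {β : Module.Dual ℝ V} (hβ : β ∈ 𝔸.realRoots) : k β = (c β : WithTop ℝ) := if_pos hβ
  refine ⟨{v | ∀ β ∈ 𝔸.roots, v ∈ halfSpace β (k β)},
    isEnclosed_of_forall fun β _ => ?_, fun β _ => ?_, ?_⟩
  · by_cases hβ : β ∈ 𝔸.realRoots
    · rw [hk hβ]
      exact Or.inr ⟨_, rfl, Or.inl (hc β hβ).2⟩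
    · exact Or.inl (if_neg hβ)
  · by_cases hβ : β ∈ 𝔸.realRoots
    · rw [hk hβ, mem_halfSpace_coe]
      linarith [(hc β hβ).1]
    · simp only [k, if_neg hβ]
      exact mem_halfSpace_top
  -- The walls chosen for a simple root and for its opposite bound it on both sides.
  · refine ⟨∑ i, (|𝔸.root i x| + |c (𝔸.root i)| + |c (-𝔸.root i)|), fun v hv i => ?_⟩
    have h1 := 𝔸.root_mem_realRoots i
    have h2 := neg_mem_realRoots h1
    have h3 := hv _ (Or.inl h1)
    have h4 := hv _ (Or.inl h2)
    rw [hk h1, mem_halfSpace_coe] at h3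
    rw [hk h2, mem_halfSpace_coe, LinearMap.neg_apply] at h4
    refine le_trans ?_ (Finset.single_le_sum
      (f := fun i => |𝔸.root i x| + |c (𝔸.root i)| + |c (-𝔸.root i)|)
      (fun i _ => by positivity) (Finset.mem_univ i))
    rw [map_sub, abs_le]
    constructor
    · linarith [le_abs_self (𝔸.root i x), le_abs_self (c (𝔸.root i)), abs_nonneg (c (-𝔸.root i))]
    · linarith [neg_abs_le (𝔸.root i x), le_abs_self (c (-𝔸.root i)), abs_nonneg (c (𝔸.root i))]

end

variable {V ι : Type*} [NormedAddCommGroup V] [NormedSpace ℝ V] [FiniteDimensional ℝ V]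
  [Fintype ι] {𝔸 : Apartment V ι}

theorem IsEnclosed.isClosed {Q : Set V} (hQ : 𝔸.IsEnclosed Q) : IsClosed Q := by
  obtain ⟨k, -, h⟩ := hQ.exists_levels
  have : Q = ⋂ β ∈ 𝔸.roots, ⋂ r : ℝ, ⋂ _ : k β = r, {v | 0 ≤ β v + r} := by
    ext v; simp [h]
  rw [this]
  refine isClosed_biInter fun β _ => isClosed_iInter fun r => isClosed_iInter fun _ => ?_
  exact isClosed_le continuous_const
    (β.continuous_of_finiteDimensional.add continuous_const)

/-- The roots that bound an enclosed set containing a half-line are nonnegative on the facet of its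
direction. -/
theorem nonneg_of_halfLine {k : Module.Dual ℝ V → WithTop ℝ} {F : Set V} (hF : 𝔸.IsVFacet F)
    {a ζ : V} (hζ : ζ ∈ F)
    (ha : ∀ t : ℝ, 0 ≤ t → ∀ β ∈ 𝔸.roots, ∀ r : ℝ, k β = r → 0 ≤ β (a + t • ζ) + r)
    {β : Module.Dual ℝ V} (hβ : β ∈ 𝔸.roots) {r : ℝ} (hr : k β = r) {c : V}
    (hc : c ∈ closure F) : 0 ≤ β c := by
  refine root_nonneg_facet hF hβ hζ hc ?_
  by_contra hneg
  push Not at hneg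
  have h0 := ha 0 le_rfl β hβ r hr
  simp only [zero_smul, add_zero] at h0
  -- For this parameter the expression would equal `-1`.
  have h1 := ha ((β a + r + 1) / (-β ζ)) (div_nonneg (by linarith) (by linarith)) β hβ r hr
  rw [map_add, map_smul, smul_eq_mul] at h1
  have h2 : (β a + r + 1) / (-β ζ) * β ζ = -(β a + r + 1) := by
    field_simp [hneg.ne]
  linarith

/-- An enclosed set that contains a half-line is stable under translation by the closure of the
facet of its direction. -/
theorem IsEnclosed.add_mem {Q : Set V} (hQ : 𝔸.IsEnclosed Q) {F : Set V} (hF : 𝔸.IsVFacet F)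
    {a ζ : V} (hζ : ζ ∈ F) (ha : ∀ t : ℝ, 0 ≤ t → a + t • ζ ∈ Q) {b c : V} (hb : b ∈ Q)
    (hc : c ∈ closure F) : b + c ∈ Q := by
  obtain ⟨k, -, h⟩ := hQ.exists_levels
  simp only [h] at ha hb ⊢
  intro β hβ r hr
  have h1 := nonneg_of_halfLine hF hζ ha hβ hr hc
  have h2 := hb β hβ r hr
  rw [map_add]
  linarith

/-! ### Germs of sector faces -/

theorem closure_vadd_eq_of_vadd_eq {V : Type*} [NormedAddCommGroup V] {F G : Set V} {x y : V}
    (h : x +ᵥ F = y +ᵥ G) :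
    x +ᵥ closure F = y +ᵥ closure G := by
  rw [← closure_vadd, ← closure_vadd, h]

theorem mem_sectorFaceGerm {F : Set V} (hF : 𝔸.IsVFacet F) {x : V} {M : Set V} :
    M ∈ sectorFaceGerm x F ↔ ∃ ξ ∈ closure F, (x + ξ) +ᵥ F ⊆ M := by
  rw [sectorFaceGerm, mem_biInf_of_directed]
  · simp only [mem_principal]
  · intro ξ hξ η hη
    refine ⟨ξ + η, facet_closure_add_closure hF hξ hη, ?_, ?_⟩ <;>
      simp only [ge_iff_le, Order.Preimage, principal_mono] <;> rintro _ ⟨u, hu, rfl⟩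
    · exact ⟨η + u, facet_closure_add hF hη hu, by simp only [vadd_eq_add]; abel⟩
    · exact ⟨ξ + u, facet_closure_add hF hξ hu, by simp only [vadd_eq_add]; abel⟩
  · exact ⟨0, zero_mem_closure_facet hF⟩

theorem vadd_mem_sectorFaceGerm {F : Set V} (hF : 𝔸.IsVFacet F) (x : V) :
    x +ᵥ F ∈ sectorFaceGerm x F :=
  (mem_sectorFaceGerm hF).2 ⟨0, zero_mem_closure_facet hF, by rw [add_zero]⟩

theorem sectorFaceGerm_add {F : Set V} (hF : 𝔸.IsVFacet F) (x : V) {ξ : V} (hξ : ξ ∈ closure F) :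
    sectorFaceGerm (x + ξ) F = sectorFaceGerm x F := by
  ext M
  rw [mem_sectorFaceGerm hF, mem_sectorFaceGerm hF]
  constructor
  · rintro ⟨η, hη, h⟩
    exact ⟨ξ + η, facet_closure_add_closure hF hξ hη, by rwa [← add_assoc]⟩
  · rintro ⟨η, hη, h⟩
    refine ⟨η, hη, Subset.trans ?_ h⟩
    rintro _ ⟨u, hu, rfl⟩
    exact ⟨ξ + u, facet_closure_add hF hξ hu, by simp only [vadd_eq_add]; abel⟩

/-- A sector face of direction `F` that contains a translate of `G` has `G` among its asymptotic
directions; so each facet lies in the closure of the other. -/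
theorem direction_eq_of_sectorFaceGerm_eq {F G : Set V} (hF : 𝔸.IsVFacet F) (hG : 𝔸.IsVFacet G)
    {x y : V} (h : sectorFaceGerm x F = sectorFaceGerm y G) : F = G := by
  have key {F G : Set V} (hF : 𝔸.IsVFacet F) (hG : 𝔸.IsVFacet G) {x y : V}
      (h : sectorFaceGerm x F = sectorFaceGerm y G) : G ⊆ closure F := by
    have h1 := vadd_mem_sectorFaceGerm hF x
    rw [h, mem_sectorFaceGerm hG] at h1
    obtain ⟨ξ, -, h2⟩ := h1
    exact subset_closure_of_vadd_subset hF hG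
      (h2.trans (vadd_set_mono subset_closure))
  exact facet_eq_of_subset_closure hF hG (key hG hF h.symm) (key hF hG h)

theorem direction_eq_of_vadd_eq {F G : Set V} (hF : 𝔸.IsVFacet F) (hG : 𝔸.IsVFacet G)
    {x y : V} (h : x +ᵥ F = y +ᵥ G) : F = G :=
  facet_eq_of_subset_closure hF hG
    (subset_closure_of_vadd_subset hG hF (h.le.trans (vadd_set_mono subset_closure)))
    (subset_closure_of_vadd_subset hF hG (h.ge.trans (vadd_set_mono subset_closure)))

theorem sectorFaceGerm_eq_of_vadd_eq {F G : Set V} (hF : 𝔸.IsVFacet F) (hG : 𝔸.IsVFacet G)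
    {x y : V} (h : x +ᵥ F = y +ᵥ G) : sectorFaceGerm x F = sectorFaceGerm y G := by
  obtain rfl := direction_eq_of_vadd_eq hF hG h
  have h1 : x ∈ y +ᵥ closure F := by
    rw [← closure_vadd_eq_of_vadd_eq h]
    exact ⟨0, zero_mem_closure_facet hF, by simp⟩
  obtain ⟨ξ, hξ, rfl⟩ := h1
  exact sectorFaceGerm_add hF y hξ

theorem map_sectorFaceGerm {F : Set V} (hF : 𝔸.IsVFacet F) (g : V ≃ᵃ[ℝ] V)
    (hF' : 𝔸.IsVFacet (g.linear '' F)) (x : V) :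
    map g (sectorFaceGerm x F) = sectorFaceGerm (g x) (g.linear '' F) := by
  have hcl : closure (g.linear '' F) = g.linear '' closure F :=
    (g.linear.toContinuousLinearEquiv.toHomeomorph.image_closure F).symm
  have hadd (a b : V) : g (a + b) = g a + g.linear b := by
    have := g.map_vadd a b
    simp only [vadd_eq_add] at this
    rw [add_comm a b, this, add_comm]
  ext M
  rw [mem_map, mem_sectorFaceGerm hF, mem_sectorFaceGerm hF', hcl]
  constructor
  · rintro ⟨ξ, hξ, h⟩
    refine ⟨_, ⟨ξ, hξ, rfl⟩, ?_⟩
    rw [← hadd, ← affineEquiv_image_vadd, image_subset_iff]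
    exact h
  · rintro ⟨_, ⟨ξ, hξ, rfl⟩, h⟩
    refine ⟨ξ, hξ, ?_⟩
    rwa [← hadd, ← affineEquiv_image_vadd, image_subset_iff] at h

/-! ### Chimneys -/

/-- An element of the facet need not contain `x`, but it accumulates there. This is enough below
because enclosed sets are closed. -/
theorem mem_of_mem_facet {x : V} {F₀ : Set V} (hF₀ : 𝔸.IsVFacet F₀) {M : Set V}
    (hM : M ∈ 𝔸.facet x F₀) : x ∈ closure M := by
  obtain ⟨Q, -, hQ, hQM⟩ := hM
  have hx : x ∈ closure (x +ᵥ F₀) := by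
    rw [closure_vadd]
    exact ⟨0, zero_mem_closure_facet hF₀, by simp⟩
  have := mem_closure_iff_nhdsWithin_neBot.1 hx
  have h1 : ∃ᶠ v in 𝓝[x +ᵥ F₀] x, v ∈ M :=
    Eventually.frequently (mem_of_superset hQ hQM)
  exact mem_closure_iff_frequently.2 (h1.filter_mono nhdsWithin_le_nhds)

theorem add_mem_of_mem_cl {x ξ : V} {F₀ F : Set V} (hF₀ : 𝔸.IsVFacet F₀) {M : Set V}
    (hM : M ∈ 𝔸.cl (𝔸.facet x F₀ + 𝓟 (ξ +ᵥ F))) : (x + ξ) +ᵥ closure F ⊆ M := by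
  obtain ⟨Q, hQ, hQm, hQM⟩ := hM
  refine Subset.trans ?_ hQM
  obtain ⟨T, hT, U, hU, hTU⟩ := Filter.mem_add.1 hQm
  rw [mem_principal] at hU
  rw [← closure_vadd]
  refine closure_minimal ?_ hQ.isClosed
  rintro _ ⟨u, hu, rfl⟩
  have hc : Continuous fun p : V => p + (ξ + u) := by fun_prop
  have h := map_mem_closure hc (mem_of_mem_facet hF₀ hT) (t := Q) fun p hp =>
    hTU (add_mem_add hp (hU ⟨u, hu, rfl⟩))
  rw [hQ.isClosed.closure_eq] at h
  simpa [add_assoc] using h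

theorem sectorFaceGerm_le_chimneyGerm (x : V) {F₀ F : Set V} (hF₀ : 𝔸.IsVFacet F₀) :
    sectorFaceGerm x F ≤ 𝔸.chimneyGerm x F₀ F :=
  iInf₂_mono fun _ _ _ hM => mem_of_superset (mem_principal_self _)
    ((vadd_set_mono subset_closure).trans (add_mem_of_mem_cl hF₀ hM))

/-- The direction of the support contains `F`, whose fixer is finite. -/
theorem isSolid_chimney (x : V) {F₀ F : Set V} (hF₀ : 𝔸.IsVFacet F₀)
    (hF : 𝔸.IsSphericalVFacet F) : 𝔸.IsSolid (𝔸.chimney x F₀ F) := by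
  refine (fixer_finite hF).subset fun w ⟨hw, h⟩ => ⟨hw, fun v hv => h v ?_⟩
  have hsub : x +ᵥ closure F ⊆ (support (𝔸.chimney x F₀ F) : Set V) := by
    rw [support, AffineSubspace.coe_sInf]
    refine subset_iInter₂ fun E hE => ?_
    have hE' : (E : Set V) ∈ 𝔸.cl (𝔸.facet x F₀ + 𝓟 ((0 : V) +ᵥ F)) := by
      rw [zero_vadd]; exact hE
    simpa using add_mem_of_mem_cl hF₀ hE'
  have h1 := AffineSubspace.vsub_mem_direction (hsub ⟨v, subset_closure hv, rfl⟩)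
    (hsub ⟨0, zero_mem_closure_facet hF.isVFacet, rfl⟩)
  simpa using h1

theorem isSolidChimneyGerm {F₀ F : Set V} (hF₀ : 𝔸.IsVFacet F₀) (hF : 𝔸.IsSphericalVFacet F)
    (x : V) : 𝔸.IsSolidChimneyGerm (𝔸.chimneyGerm x F₀ F) :=
  ⟨x, F₀, F, hF₀, hF.isVFacet, isSolid_chimney x hF₀ hF, rfl⟩

/-- A vector of a spherical facet can be lengthened so as to absorb, with respect to the roots
positive on this facet, a set of bounded vectors. -/
theorem exists_smul_nonneg {F : Set V} (hF : 𝔸.IsSphericalVFacet F) {ζ : V} (hζ : ζ ∈ F) (C : ℝ) :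
    ∃ T : ℝ, 0 < T ∧ ∀ v, (∀ i, |𝔸.root i v| ≤ C) →
      ∀ β ∈ 𝔸.roots, 0 < β ζ → 0 ≤ β (v + T • ζ) := by
  classical
  obtain ⟨ω, hω⟩ := 𝔸.exists_coweights
  -- Only the values of the simple roots matter, so the neighbourhood of `ζ` is read in these
  -- coordinates; boundedness of `v` itself is not available.
  let σ : (ι → ℝ) → V := fun a => ζ + ∑ j, a j • ω j
  have hσ : Continuous σ := by fun_prop
  have h0 : Tendsto σ (𝓝 0) (𝓝 ζ) := by simpa [σ] using hσ.tendsto 0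
  obtain ⟨δ, hδ, hδ'⟩ := Metric.eventually_nhds_iff.1 (h0.eventually (eventually_nonneg hF hζ))
  -- With this `T` the coordinates of `T⁻¹ • v` are smaller than `δ`; `|C|` keeps `T` positive
  -- whatever the sign of `C`.
  refine ⟨(|C| + 1) / δ, by positivity, fun v hv β hβ hpos => ?_⟩
  set T := (|C| + 1) / δ
  have hT : 0 < T := by positivity
  have h1 : dist (fun i => T⁻¹ * 𝔸.root i v) (0 : ι → ℝ) < δ := by
    rw [dist_pi_lt_iff hδ]
    intro i
    rw [Pi.zero_apply, Real.dist_eq, sub_zero, abs_mul, abs_of_pos (inv_pos.2 hT),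
      inv_mul_lt_iff₀ hT]
    have : T * δ = |C| + 1 := by simp only [T]; field_simp
    rw [this]
    linarith [hv i, le_abs_self C]
  have h2 := (hδ' h1).2 β hβ hpos
  have h3 : v - ∑ j, 𝔸.root j v • ω j ∈ 𝔸.stdFacet univ := by
    refine ⟨fun i _ => ?_, fun i hi => (hi (mem_univ i)).elim⟩
    simp only [map_sub, map_sum, map_smul, hω, smul_eq_mul, mul_ite, mul_one, mul_zero,
      Finset.sum_ite_eq, Finset.mem_univ, if_true, sub_self]
  have h4 := root_stdFacet_univ hβ h3
  rw [map_sub, sub_eq_zero] at h4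
  have h5 : v + T • ζ - T • (ζ + ∑ j, (T⁻¹ * 𝔸.root j v) • ω j) =
      v - ∑ j, 𝔸.root j v • ω j := by
    rw [smul_add, Finset.smul_sum]
    simp only [smul_smul, mul_inv_cancel_left₀ hT.ne']
    abel
  have h6 : β (v + T • ζ) = T * β (ζ + ∑ j, (T⁻¹ * 𝔸.root j v) • ω j) := by
    rw [← sub_eq_zero, ← smul_eq_mul, ← map_smul, ← map_sub, h5, map_sub, h4, sub_self]
  rw [h6]
  exact mul_nonneg hT.le h2

/-- An enclosed set containing a half-line in a spherical direction `F` contains the germ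
of the chimney of direction `F` based at the minimal facet of `x`. -/
theorem IsEnclosed.mem_chimneyGerm {Q : Set V} (hQ : 𝔸.IsEnclosed Q) {F : Set V}
    (hF : 𝔸.IsSphericalVFacet F) {x ξ ζ : V} (hξ : ξ ∈ closure F) (hζ : ζ ∈ F)
    (h : ∀ t : ℝ, 0 ≤ t → x + ξ + t • ζ ∈ Q) : Q ∈ 𝔸.chimneyGerm x (𝔸.stdFacet univ) F := by
  classical
  obtain ⟨k, hk, hkQ⟩ := hQ.exists_levels
  obtain ⟨Q₂, hQ₂, hx₂, C, hC⟩ := 𝔸.exists_isEnclosed_bounded x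
  obtain ⟨T, hT, hT'⟩ := exists_smul_nonneg hF hζ C
  have hx : x + ξ ∈ Q := by simpa using h 0 le_rfl
  have hnn {β : Module.Dual ℝ V} (hβ : β ∈ 𝔸.roots) {r : ℝ} (hr : k β = r) {c : V}
      (hc : c ∈ closure F) : 0 ≤ β c :=
    nonneg_of_halfLine hF.isVFacet hζ (fun t ht => (hkQ _).1 (h t ht)) hβ hr hc
  -- The base of the chimney must obey the constraints of `Q` by roots vanishing at `ζ`, which no
  -- translation along `F` can improve. The other roots bounding `Q` are positive at `ζ`; `T • ζ`
  -- absorbs their variation on the bounded set `Q₂`.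
  let l : Module.Dual ℝ V → WithTop ℝ := fun β => if β ζ = 0 then k β else ⊤
  have hQ₁ : 𝔸.IsEnclosed {v | ∀ β ∈ 𝔸.roots, v ∈ halfSpace β (l β)} := by
    refine isEnclosed_of_forall fun β hβ => ?_
    by_cases h0 : β ζ = 0
    · simp only [l, if_pos h0]
      exact hk β hβ
    · exact Or.inl (if_neg h0)
  set Q₁ := {v | ∀ β ∈ 𝔸.roots, v ∈ halfSpace β (l β)}
  have hx₁ : x ∈ Q₁ := by
    intro β hβ
    by_cases h0 : β ζ = 0
    · simp only [l, if_pos h0]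
      rcases hr : k β with _ | r
      · exact mem_halfSpace_top
      · have := (hkQ _).1 hx β hβ r hr
        rw [map_add, root_eq_zero_facet hF.isVFacet hβ hζ hξ h0, add_zero] at this
        exact mem_halfSpace_coe.2 this
    · simp only [l, if_neg h0]
      exact mem_halfSpace_top
  have hfac : Q₁ ∩ Q₂ ∈ 𝔸.facet x (𝔸.stdFacet univ) := by
    refine ⟨_, (hQ₁.inter 𝔸 hQ₂).isSemiEnclosed, ?_, Subset.rfl⟩
    refine mem_of_superset self_mem_nhdsWithin ?_
    rintro _ ⟨u, hu, rfl⟩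
    refine (hQ₁.inter 𝔸 hQ₂).add_mem (𝔸.isVFacet_stdFacet univ) (a := x)
      (zero_mem_stdFacet_univ (𝔸 := 𝔸)) (fun t _ => ?_) ⟨hx₁, hx₂⟩ (subset_closure hu)
    rw [smul_zero, add_zero]
    exact ⟨hx₁, hx₂⟩
  have hξ' : ξ + T • ζ ∈ closure F :=
    facet_closure_add_closure hF.isVFacet hξ (subset_closure (facet_smul hF.isVFacet hζ hT))
  refine mem_iInf_of_mem (ξ + T • ζ) (mem_iInf_of_mem hξ' ?_)
  refine ⟨Q, hQ, Filter.mem_add.2 ⟨_, hfac, _, mem_principal_self _, ?_⟩, Subset.rfl⟩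
  rintro _ ⟨v, ⟨hv₁, hv₂⟩, _, ⟨u, hu, rfl⟩, rfl⟩
  simp only [vadd_eq_add]
  rw [hkQ]
  intro β hβ r hr
  have hu0 := hnn hβ hr (subset_closure hu)
  have hz0 := hnn hβ hr (subset_closure hζ)
  rcases hz0.eq_or_lt with h0 | h0
  · have h1 := hv₁ β hβ
    simp only [l, if_pos h0.symm] at h1
    rw [hr, mem_halfSpace_coe] at h1
    simp only [map_add, map_smul, ← h0, smul_zero, add_zero]
    linarith [hnn hβ hr hξ]
  · have h1 := hT' (v - x) (hC v hv₂) β hβ h0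
    have h2 := (hkQ _).1 hx β hβ r hr
    simp only [map_add, map_sub] at h1 h2 ⊢
    linarith

end Apartment

end Hovel

namespace Hovel

namespace Apartment

open SimpleRoots

variable {V ι : Type*} [NormedAddCommGroup V] [NormedSpace ℝ V] [FiniteDimensional ℝ V]
  [Fintype ι] {𝔸 : Apartment V ι}

theorem exists_mem_cl_of_mem_chimneyGerm {x : V} {F₀ F : Set V} (hF : 𝔸.IsVFacet F) {M : Set V}
    (hM : M ∈ 𝔸.chimneyGerm x F₀ F) :
    ∃ ξ ∈ closure F, M ∈ 𝔸.cl (𝔸.facet x F₀ + 𝓟 (ξ +ᵥ F)) := by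
  have hmono {G G' : Filter V} (h : G ≤ G') : 𝔸.cl G ≤ 𝔸.cl G' :=
    fun M ⟨Q, hQ, hQG, hQM⟩ => ⟨Q, hQ, h hQG, hQM⟩
  rw [chimneyGerm, mem_biInf_of_directed] at hM
  · exact hM
  · intro ξ hξ η hη
    refine ⟨ξ + η, facet_closure_add_closure hF hξ hη, ?_, ?_⟩ <;>
      refine hmono (add_le_add le_rfl (principal_mono.2 ?_)) <;> rintro _ ⟨u, hu, rfl⟩
    · exact ⟨η + u, facet_closure_add hF hη hu, by simp only [vadd_eq_add]; abel⟩
    · exact ⟨ξ + u, facet_closure_add hF hξ hu, by simp only [vadd_eq_add]; abel⟩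
  · exact ⟨0, zero_mem_closure_facet hF⟩

/-- An enclosed set that contains a germ of sector face of direction `F` is stable under translation
by the closure of `F`. -/
theorem IsEnclosed.add_mem_of_germ {Q : Set V} (hQ : 𝔸.IsEnclosed Q) {F : Set V}
    (hF : 𝔸.IsVFacet F) {p : V} (hp : Q ∈ sectorFaceGerm p F) {b c : V} (hb : b ∈ Q)
    (hc : c ∈ closure F) : b + c ∈ Q := by
  obtain ⟨ξ, -, hsub⟩ := (mem_sectorFaceGerm hF).1 hp
  obtain ⟨ζ, hζ⟩ := facet_nonempty hF
  refine hQ.add_mem hF hζ (a := p + ξ + ζ) (fun t ht => hsub ?_) hb hc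
  exact ⟨(1 + t) • ζ, facet_smul hF hζ (by linarith), by simp only [vadd_eq_add]; module⟩

end Apartment

namespace AffineHovel

open SimpleRoots Apartment

variable {V ι : Type*} [NormedAddCommGroup V] [NormedSpace ℝ V]
  [Fintype ι]
  {𝔸 : Apartment V ι} {X : Type*} {S : AffineHovel 𝔸 X}

/-! ### Comparison of charts -/

theorem mem_map_of_chart {A : Set X} (hA : A ∈ S.apts) {f : V → X} (hf : f ∈ S.isom A)
    (G : Filter V) : A ∈ map f G := by
  rw [← S.isom_range A hA f hf]
  exact range_mem_map

theorem exists_chart_of_shares {A A' : Set X} {f : V → X} (hf : f ∈ S.isom A)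
    {G : Filter X} (h : S.SharesEnclosure A A' G) :
    ∃ f' ∈ S.isom A', ∃ Q, 𝔸.IsEnclosed Q ∧ Q ∈ comap f G ∧ ∀ v ∈ Q, f' v = f v := by
  obtain ⟨-, f', hf', Q, hQ, hQG, h⟩ := h f hf
  exact ⟨f', hf', Q, hQ, hQG, h⟩

theorem exists_chart_of_ma2 {A A' : Set X} (hA : A ∈ S.apts) (hA' : A' ∈ S.apts) {f : V → X}
    (hf : f ∈ S.isom A) {H : Filter V}
    (hH : IsPoint H ∨ 𝔸.IsPreorderedIntervalGerm H ∨ 𝔸.IsGenericHalfLine H ∨ 𝔸.IsSolidChimney H)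
    (h : A' ∈ map f H) :
    ∃ f' ∈ S.isom A', ∃ Q, 𝔸.IsEnclosed Q ∧ Q ∈ H ∧ ∀ v ∈ Q, f' v = f v := by
  have := exists_chart_of_shares hf (S.ma2 A hA A' hA' f hf H hH h)
  rwa [comap_map (S.isom_injective A hA f hf)] at this

theorem mem_of_chart_eq {A' : Set X} (hA' : A' ∈ S.apts) {f f' : V → X} (hf' : f' ∈ S.isom A')
    {v : V} (h : f' v = f v) : f v ∈ A' := by
  rw [← h, ← S.isom_range A' hA' f' hf']
  exact mem_range_self v

/-- Two apartments that share a half-line in a spherical direction share its enclosure. -/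
theorem exists_chart_halfLine {A A' : Set X} (hA : A ∈ S.apts) (hA' : A' ∈ S.apts) {f : V → X}
    (hf : f ∈ S.isom A) {F : Set V} (hF : 𝔸.IsSphericalVFacet F) {a ζ : V} (hζ : ζ ∈ F)
    (h : ∀ t : ℝ, 0 ≤ t → f (a + t • ζ) ∈ A') :
    ∃ f' ∈ S.isom A', ∃ Q, 𝔸.IsEnclosed Q ∧ (∀ t : ℝ, 0 ≤ t → a + t • ζ ∈ Q) ∧
      ∀ v ∈ Q, f' v = f v := by
  -- A spherical facet may contain `0`; the half-line is then a point, a separate case of (MA2).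
  by_cases h0 : ζ = 0
  · obtain ⟨f', hf', Q, hQ, hQa, h'⟩ := exists_chart_of_ma2 hA hA' hf
      (H := 𝓟 {a}) (Or.inl ⟨a, rfl⟩) (by simpa [h0] using h 0 le_rfl)
    exact ⟨f', hf', Q, hQ, fun t _ => by simpa [h0] using hQa, h'⟩
  · obtain ⟨f', hf', Q, hQ, hQa, h'⟩ := exists_chart_of_ma2 hA hA' hf
      (H := 𝓟 ((fun t : ℝ => a + t • ζ) '' Ici 0))
      (Or.inr (Or.inr (Or.inl ⟨a, ζ, h0, ⟨F, hF, hζ⟩, rfl⟩))) (by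
        rw [mem_map, mem_principal]
        rintro _ ⟨t, ht, rfl⟩
        exact h t ht)
    exact ⟨f', hf', Q, hQ, fun t ht => hQa ⟨t, ht, rfl⟩, h'⟩

theorem exists_weyl {A : Set X} (hA : A ∈ S.apts) {f f' : V → X} (hf : f ∈ S.isom A)
    (hf' : f' ∈ S.isom A) : ∃ w ∈ 𝔸.W, f' = f ∘ w :=
  (S.isom_iff A hA f hf f').1 hf'

theorem IsChart.injective {f : V → X} (hf : S.IsChart f) : Function.Injective f := by
  obtain ⟨A, hA, hf⟩ := hf
  exact S.isom_injective A hA f hf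

theorem map_sectorFaceGerm_congr {V : Type*} [NormedAddCommGroup V] {f f' : V → X}
    {F : Set V} {x : V} {Q : Set V}
    (hQ : Q ∈ sectorFaceGerm x F) (h : ∀ v ∈ Q, f' v = f v) :
    map f' (sectorFaceGerm x F) = map f (sectorFaceGerm x F) :=
  map_congr (mem_of_superset hQ h)

variable [FiniteDimensional ℝ V]

/-- An apartment that contains a spherical sector face contains its closure, and has a chart that
agrees with a given one there. -/
theorem exists_chart_closure {A A' : Set X} (hA : A ∈ S.apts) (hA' : A' ∈ S.apts) {f : V → X}
    (hf : f ∈ S.isom A) {F : Set V} (hF : 𝔸.IsSphericalVFacet F) {x : V}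
    (h : f '' (x +ᵥ F) ⊆ A') :
    ∃ f' ∈ S.isom A', EqOn f' f (x +ᵥ closure F) := by
  have hF' := hF.isVFacet
  obtain ⟨ζ, hζ⟩ := facet_nonempty hF'
  have hpos : ∀ t : ℝ, 0 < t → f (x + t • ζ) ∈ A' := fun t ht =>
    h ⟨_, ⟨t • ζ, facet_smul hF' hζ ht, rfl⟩, rfl⟩
  have hx : f x ∈ A' := by
    by_cases h0 : ζ = 0
    · simpa [h0] using hpos 1 one_pos
    -- (MA2) for the germ of an interval without its origin `x`: the shared enclosed set is closed,
    -- so it contains `x`.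
    obtain ⟨f', hf', Q, hQ, hQx, h'⟩ := exists_chart_of_ma2 hA hA' hf
      (H := 𝓝[(fun t : ℝ => x + t • ζ) '' Ioc 0 1] x)
      (Or.inr (Or.inl ⟨x, ζ, h0, hF'.titsCone_or hζ, rfl⟩)) (by
        rw [mem_map]
        refine mem_of_superset self_mem_nhdsWithin ?_
        rintro _ ⟨t, ht, rfl⟩
        exact hpos t ht.1)
    refine mem_of_chart_eq hA' hf' (h' x ?_)
    have hc : Tendsto (fun t : ℝ => x + t • ζ) (𝓝[>] 0)
        (𝓝[(fun t : ℝ => x + t • ζ) '' Ioc 0 1] x) := by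
      refine tendsto_nhdsWithin_iff.2 ⟨?_, ?_⟩
      · have : Continuous fun t : ℝ => x + t • ζ := by fun_prop
        have := this.tendsto 0
        simp only [zero_smul, add_zero] at this
        exact this.mono_left nhdsWithin_le_nhds
      · filter_upwards [Ioc_mem_nhdsGT (zero_lt_one' ℝ)] with t ht using ⟨t, ht, rfl⟩
    have hc' : Tendsto (fun t : ℝ => x + t • ζ) (𝓝[>] 0) (𝓝 x) := hc.mono_right nhdsWithin_le_nhds
    exact hQ.isClosed.mem_of_tendsto hc' (hc hQx)
  obtain ⟨f', hf', Q, hQ, hQx, h'⟩ := exists_chart_halfLine hA hA' hf hF hζ (a := x) (by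
    intro t ht
    rcases ht.eq_or_lt with rfl | ht
    · simpa using hx
    · exact hpos t ht)
  refine ⟨f', hf', ?_⟩
  rintro _ ⟨c, hc, rfl⟩
  exact h' _ (hQ.add_mem hF' hζ hQx (by simpa using hQx 0 le_rfl) hc)

/-- An apartment that contains the germ of a spherical sector face contains the germ of the smallest
chimney of the same direction. -/
theorem mem_map_chimneyGerm {A A' : Set X} (hA : A ∈ S.apts) (hA' : A' ∈ S.apts) {f : V → X}
    (hf : f ∈ S.isom A) {F : Set V} (hF : 𝔸.IsSphericalVFacet F) {x : V}
    (h : A' ∈ map f (sectorFaceGerm x F)) :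
    A' ∈ map f (𝔸.chimneyGerm x (𝔸.stdFacet univ) F) := by
  have hF' := hF.isVFacet
  obtain ⟨ξ, hξ, hsub⟩ := (mem_sectorFaceGerm hF').1 h
  obtain ⟨ζ, hζ⟩ := facet_nonempty hF'
  obtain ⟨f', hf', Q, hQ, hQx, h'⟩ := exists_chart_halfLine hA hA' hf hF hζ (a := x + (ξ + ζ)) (by
    intro t ht
    refine hsub ⟨(1 + t) • ζ, facet_smul hF' hζ (by linarith), ?_⟩
    simp only [vadd_eq_add]
    module)
  have h1 := hQ.mem_chimneyGerm hF
    (facet_closure_add_closure hF' hξ (subset_closure hζ)) hζ hQx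
  rw [mem_map]
  exact mem_of_superset h1 fun v hv => mem_of_chart_eq hA' hf' (h' v hv)

/-- Two apartments containing the germ of a spherical sector face and a facet or germ of solid
chimney `K` share their enclosure. -/
theorem exists_chart_of_ma4 {A A' : Set X} (hA : A ∈ S.apts) (hA' : A' ∈ S.apts) {f : V → X}
    (hf : f ∈ S.isom A) {F : Set V} (hF : 𝔸.IsSphericalVFacet F) {p : V}
    (h : A' ∈ map f (sectorFaceGerm p F)) {K : Filter X}
    (hK : S.IsOfKind 𝔸.IsFacet K ∨ S.IsOfKind 𝔸.IsSolidChimneyGerm K)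
    (hAK : A ∈ K) (hAK' : A' ∈ K) :
    ∃ f' ∈ S.isom A', ∃ Q, 𝔸.IsEnclosed Q ∧ Q ∈ sectorFaceGerm p F ∧ Q ∈ comap f K ∧
      ∀ v ∈ Q, f' v = f v := by
  have h0 := 𝔸.isVFacet_stdFacet univ
  have hR : S.IsOfKind 𝔸.IsSplayedChimneyGerm
      (map f (𝔸.chimneyGerm p (𝔸.stdFacet univ) F)) :=
    ⟨A, hA, f, hf, _, isSplayedChimneyGerm h0 hF p, rfl⟩
  obtain ⟨f', hf', Q, hQ, hQm, h'⟩ := exists_chart_of_shares hf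
    (S.ma4 _ K hR hK A hA A' hA' (mem_map_of_chart hA hf _) hAK
      (mem_map_chimneyGerm hA hA' hf hF h) hAK')
  rw [comap_sup, comap_map (S.isom_injective A hA f hf), mem_sup] at hQm
  exact ⟨f', hf', Q, hQ, sectorFaceGerm_le_chimneyGerm p h0 hQm.1, hQm.2, h'⟩

theorem isOfKind_chimneyGerm {A : Set X} (hA : A ∈ S.apts) {f : V → X} (hf : f ∈ S.isom A)
    {F : Set V} (hF : 𝔸.IsSphericalVFacet F) (x : V) :
    S.IsOfKind 𝔸.IsSolidChimneyGerm (map f (𝔸.chimneyGerm x (𝔸.stdFacet univ) F)) :=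
  ⟨A, hA, f, hf, _, isSolidChimneyGerm (𝔸.isVFacet_stdFacet univ) hF x, rfl⟩

/-- A germ of sector face in an apartment, read in another chart of this apartment. -/
theorem map_comp_sectorFaceGerm {f : V → X} {w : V ≃ᵃ[ℝ] V} (hw : w ∈ 𝔸.W) {F : Set V}
    (hF : 𝔸.IsSphericalVFacet F) (x : V) :
    map (f ∘ w) (sectorFaceGerm x F) = map f (sectorFaceGerm (w x) (w.linear '' F)) := by
  rw [← Filter.map_map,
    map_sectorFaceGerm hF.isVFacet w (hF.image (linear_mem_Wv hw)).isVFacet]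

theorem direction_unique {f : V → X} (hf : S.IsChart f) {F G : Set V}
    (hF : 𝔸.IsSphericalVFacet F) (hG : 𝔸.IsSphericalVFacet G) {x y : V}
    (h : map f (sectorFaceGerm x F) = map f (sectorFaceGerm y G)) : F = G :=
  direction_eq_of_sectorFaceGerm_eq hF.isVFacet hG.isVFacet (map_injective hf.injective h)

/-! ### Moving a sector face parallel to itself in an apartment -/

section Path

variable {K : Filter X} (hK : S.IsOfKind 𝔸.IsFacet K ∨ S.IsOfKind 𝔸.IsSolidChimneyGerm K)
  {Φ : Filter X → Prop}
  (hΦ : ∀ B ∈ S.apts, B ∈ K → ∀ h ∈ S.isom B, ∀ (p p' : V) (H : Set V), 𝔸.IsSphericalVFacet H →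
    Φ (map h (sectorFaceGerm p H)) → Φ (map h (sectorFaceGerm p' H)))
  {f : V → X} (hf : S.IsChart f) {F : Set V} (hF : 𝔸.IsSphericalVFacet F)
include hK hΦ hf hF

/-- By (MA3) some apartment contains `K` and the germ of the chimney based at `F(p, F₀)`. The base
contains the beginning of the half-line `p + t • v`, so all nearby parallel germs on this side lie
in that apartment. -/
theorem germ_invariant_right {F₀ : Set V} (hF₀ : 𝔸.IsVFacet F₀) {v : V} (hv : v ∈ F₀) (p : V) :
    ∃ ε > 0, ∀ t : ℝ, 0 < t → t < ε →
      (Φ (map f (sectorFaceGerm (p + t • v) F)) ↔ Φ (map f (sectorFaceGerm p F))) := by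
  have hF' := hF.isVFacet
  obtain ⟨A, hA, hf⟩ := hf
  obtain ⟨B, hB, hBR, hBK⟩ := S.ma3 (map f (𝔸.chimneyGerm p F₀ F)) K
    ⟨A, hA, f, hf, _, isSplayedChimneyGerm hF₀ hF p, rfl⟩ hK
  have hBp : B ∈ map f (sectorFaceGerm p F) :=
    map_mono (sectorFaceGerm_le_chimneyGerm p hF₀) hBR
  obtain ⟨ξ, hξ, Q, hQ, hQm, hQB⟩ := exists_mem_cl_of_mem_chimneyGerm hF' hBR
  obtain ⟨T, ⟨Q', -, hQ', hQT⟩, U, hU, hTU⟩ := Filter.mem_add.1 hQm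
  have hc : Tendsto (fun t : ℝ => p + t • v) (𝓝[>] 0) (𝓝[p +ᵥ F₀] p) := by
    refine tendsto_nhdsWithin_iff.2 ⟨?_, ?_⟩
    · have : Continuous fun t : ℝ => p + t • v := by fun_prop
      have := this.tendsto 0
      simp only [zero_smul, add_zero] at this
      exact this.mono_left nhdsWithin_le_nhds
    · filter_upwards [self_mem_nhdsWithin] with t ht using ⟨t • v, facet_smul hF₀ hv ht, rfl⟩
  obtain ⟨ε, hε, hεT⟩ := mem_nhdsGT_iff_exists_Ioo_subset.1 (hc hQ')
  refine ⟨ε, hε, fun t ht0 htε => ?_⟩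
  have hBt : B ∈ map f (sectorFaceGerm (p + t • v) F) := by
    rw [mem_map, mem_sectorFaceGerm hF']
    refine ⟨ξ, hξ, ?_⟩
    rintro _ ⟨u, hu, rfl⟩
    refine hQB (hTU ⟨_, hQT (hεT ⟨ht0, htε⟩), ξ + u, hU ⟨u, hu, rfl⟩, ?_⟩)
    simp only [vadd_eq_add, add_assoc]
  -- (MA4) for the two parallel germs: a single isomorphism fixes both, so they have the same
  -- direction in a chart of `B`, where `hΦ` applies.
  obtain ⟨h, hh, Q₁, -, hQ₁, hQ₂, heq⟩ := exists_chart_of_ma4 hA hB hf hF hBp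
    (Or.inr (isOfKind_chimneyGerm hA hf hF (p + t • v))) (mem_map_of_chart hA hf _)
    (mem_map_chimneyGerm hA hB hf hF hBt)
  rw [comap_map (S.isom_injective A hA f hf)] at hQ₂
  rw [← map_sectorFaceGerm_congr hQ₁ heq, ← map_sectorFaceGerm_congr
    (sectorFaceGerm_le_chimneyGerm _ (𝔸.isVFacet_stdFacet univ) hQ₂) heq]
  exact ⟨hΦ B hB hBK h hh _ _ F hF, hΦ B hB hBK h hh _ _ F hF⟩

/-- The one-sided statement for `v ∈ F₀` and for `-v ∈ -F₀` makes the property locally constant in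
`t`, and the real line is connected. -/
theorem germ_invariant_facet {F₀ : Set V} (hF₀ : 𝔸.IsVFacet F₀) {v : V} (hv : v ∈ F₀) (p : V) :
    Φ (map f (sectorFaceGerm (p + v) F)) ↔ Φ (map f (sectorFaceGerm p F)) := by
  have hloc : IsLocallyConstant fun t : ℝ => Φ (map f (sectorFaceGerm (p + t • v) F)) := by
    rw [IsLocallyConstant.iff_eventually_eq]
    intro t
    obtain ⟨ε₁, hε₁, h₁⟩ := germ_invariant_right hK hΦ hf hF hF₀ hv (p + t • v)
    obtain ⟨ε₂, hε₂, h₂⟩ := germ_invariant_right hK hΦ hf hF hF₀.neg (v := -v)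
      (by simpa using hv) (p + t • v)
    filter_upwards [Ioo_mem_nhds (a := t - ε₂) (b := t + ε₁) (by linarith) (by linarith)]
      with s hs
    rcases lt_trichotomy s t with hst | rfl | hst
    · have := h₂ (t - s) (by linarith) (by linarith [hs.1])
      rw [show p + t • v + (t - s) • -v = p + s • v by module] at this
      exact propext this
    · rfl
    · have := h₁ (s - t) (by linarith) (by linarith [hs.2])
      rw [show p + t • v + (s - t) • v = p + s • v by module] at this
      exact propext this
  have := hloc.apply_eq_of_preconnectedSpace 1 0
  simpa using this

/-- The vector `y - x` need not lie in a facet, but adding a large multiple of `ζ ∈ F` brings it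
into one, and this does not change the germ at the endpoint. -/
theorem germ_invariant {x y : V} (h : Φ (map f (sectorFaceGerm x F))) :
    Φ (map f (sectorFaceGerm y F)) := by
  have hF' := hF.isVFacet
  obtain ⟨ζ, hζ⟩ := facet_nonempty hF'
  have hc : Tendsto (fun s : ℝ => ζ + s • (y - x)) (𝓝[>] 0) (𝓝 ζ) := by
    have : Continuous fun s : ℝ => ζ + s • (y - x) := by fun_prop
    have := this.tendsto 0
    simp only [zero_smul, add_zero] at this
    exact this.mono_left nhdsWithin_le_nhds
  obtain ⟨s, ⟨⟨F₀, hF₀, hs⟩, -⟩, hs0⟩ :=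
    ((hc.eventually (eventually_nonneg hF hζ)).and self_mem_nhdsWithin).exists
  have hs0' : (0 : ℝ) < s := hs0
  have h1 := facet_smul hF₀ hs (inv_pos.2 hs0')
  have h2 := (germ_invariant_facet hK hΦ hf hF hF₀ h1 x).2 h
  have h3 : x + s⁻¹ • (ζ + s • (y - x)) = y + s⁻¹ • ζ := by
    rw [smul_add, smul_smul, inv_mul_cancel₀ hs0'.ne', one_smul]
    abel
  rwa [h3, sectorFaceGerm_add hF' y
    (subset_closure (facet_smul hF' hζ (inv_pos.2 hs0')))] at h2

end Path

end AffineHovel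

end Hovel

namespace Hovel

namespace AffineHovel

open SimpleRoots Apartment

variable {V ι : Type*} [NormedAddCommGroup V] [NormedSpace ℝ V] [Fintype ι]
  {𝔸 : Apartment V ι} {X : Type*} {S : AffineHovel 𝔸 X}

/-! ### Relative position of spherical sector faces -/

/-- The germs `γ` and `δ` have the directions `F` and `G` in a common chart. -/
def HasDirections (S : AffineHovel 𝔸 X) (γ δ : Filter X) (F G : Set V) : Prop :=
  𝔸.IsSphericalVFacet F ∧ 𝔸.IsSphericalVFacet G ∧ ∃ f, S.IsChart f ∧ ∃ x y,
    γ = map f (sectorFaceGerm x F) ∧ δ = map f (sectorFaceGerm y G)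

theorem HasDirections.symm {γ δ : Filter X} {F G : Set V} (h : S.HasDirections γ δ F G) :
    S.HasDirections δ γ G F := by
  obtain ⟨hF, hG, f, hf, x, y, hγ, hδ⟩ := h
  exact ⟨hG, hF, f, hf, y, x, hδ, hγ⟩

namespace SphericalSectorFace

theorem parallel_iff {s t : S.SphericalSectorFace} :
    s.Parallel t ↔ ∃ F, S.HasDirections s.germ t.germ F F :=
  ⟨fun ⟨f, hf, x, y, F, hF, hs, ht⟩ => ⟨F, hF, hF, f, hf, x, y, hs, ht⟩,
    fun ⟨F, hF, _, f, hf, x, y, hs, ht⟩ => ⟨f, hf, x, y, F, hF, hs, ht⟩⟩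

theorem dominates_iff {s t : S.SphericalSectorFace} :
    s.Dominates t ↔ ∃ F F', F' ⊆ _root_.closure F ∧ S.HasDirections s.germ t.germ F F' :=
  ⟨fun ⟨f, hf, x, y, F, F', hF, hF', h, hs, ht⟩ => ⟨F, F', h, hF, hF', f, hf, x, y, hs, ht⟩,
    fun ⟨F, F', h, hF, hF', f, hf, x, y, hs, ht⟩ => ⟨f, hf, x, y, F, F', hF, hF', h, hs, ht⟩⟩

theorem opposite_iff {s t : S.SphericalSectorFace} :
    s.Opposite t ↔ ∃ F, S.HasDirections s.germ t.germ F (-F) :=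
  ⟨fun ⟨f, hf, x, y, F, hF, hs, ht⟩ => ⟨F, hF, hF.neg, f, hf, x, y, hs, ht⟩,
    fun ⟨F, hF, _, f, hf, x, y, hs, ht⟩ => ⟨f, hf, x, y, F, hF, hs, ht⟩⟩

theorem Parallel.symm {s t : S.SphericalSectorFace} (h : s.Parallel t) : t.Parallel s := by
  obtain ⟨F, h⟩ := parallel_iff.1 h
  exact parallel_iff.2 ⟨F, h.symm⟩

theorem Parallel.dominates {s t : S.SphericalSectorFace} (h : s.Parallel t) : s.Dominates t := by
  obtain ⟨F, h⟩ := parallel_iff.1 h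
  exact dominates_iff.2 ⟨F, F, subset_closure, h⟩

theorem Opposite.symm {s t : S.SphericalSectorFace} (h : s.Opposite t) : t.Opposite s := by
  obtain ⟨F, h⟩ := opposite_iff.1 h
  exact opposite_iff.2 ⟨-F, by rw [neg_neg]; exact h.symm⟩

theorem parallel_of_germ_eq {s t : S.SphericalSectorFace} {f : V → X} (hf : S.IsChart f)
    {F : Set V} (hF : 𝔸.IsSphericalVFacet F) {x y : V} (hs : s.germ = map f (sectorFaceGerm x F))
    (ht : t.germ = map f (sectorFaceGerm y F)) : s.Parallel t :=
  ⟨f, hf, x, y, F, hF, hs, ht⟩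

/-- The sector face `x + F` in the chart `f`. -/
def ofChart {f : V → X} (hf : S.IsChart f) {F : Set V} (hF : 𝔸.IsSphericalVFacet F) (x : V) :
    S.SphericalSectorFace :=
  ⟨f '' (x +ᵥ F), f, x, F, hf, hF, rfl⟩

theorem mem_facet_stdFacet_univ {y : V} {M : Set V} (hM : M ∈ 𝔸.facet y (𝔸.stdFacet univ)) :
    y ∈ M := by
  obtain ⟨Q, -, hQ, hQM⟩ := hM
  exact hQM (mem_of_mem_nhdsWithin (s := y +ᵥ 𝔸.stdFacet univ)
    ⟨0, zero_mem_stdFacet_univ, by simp⟩ hQ)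

end SphericalSectorFace

/-! ### Independence of presentations, and reading germs in a given apartment -/

variable [FiniteDimensional ℝ V]

/-- Agreement of charts on the closure moves both presentations into one apartment, whose charts
differ by the affine Weyl group. -/
theorem presents_compare {s : Set X} {f f₂ : V → X} {x x₂ : V} {F F₂ : Set V}
    (h : S.Presents s f x F) (h₂ : S.Presents s f₂ x₂ F₂) :
    map f (sectorFaceGerm x F) = map f₂ (sectorFaceGerm x₂ F₂) ∧
      f '' (x +ᵥ closure F) = f₂ '' (x₂ +ᵥ closure F₂) := by
  obtain ⟨⟨A, hA, hf⟩, hF, rfl⟩ := h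
  obtain ⟨⟨A₂, hA₂, hf₂⟩, hF₂, hs⟩ := h₂
  obtain ⟨f', hf', heq⟩ := exists_chart_closure hA hA₂ hf hF (x := x) (by
    rw [hs, ← S.isom_range A₂ hA₂ f₂ hf₂]
    exact image_subset_range _ _)
  obtain ⟨w, hw, rfl⟩ := exists_weyl hA₂ hf₂ hf'
  have heq' : EqOn (f₂ ∘ w) f (x +ᵥ F) := heq.mono (vadd_set_mono subset_closure)
  have hwF := hF.image (linear_mem_Wv hw)
  have h1 : w x +ᵥ w.linear '' F = x₂ +ᵥ F₂ := by
    refine (S.isom_injective A₂ hA₂ f₂ hf₂).image_injective ?_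
    rw [← hs, ← affineEquiv_image_vadd, ← image_comp]
    exact heq'.image_eq
  constructor
  · rw [← map_sectorFaceGerm_congr (vadd_mem_sectorFaceGerm hF.isVFacet x) heq',
      map_comp_sectorFaceGerm hw hF,
      sectorFaceGerm_eq_of_vadd_eq hwF.isVFacet hF₂.isVFacet h1]
  · have hcl : closure (w.linear '' F) = w.linear '' closure F :=
      (w.linear.toContinuousLinearEquiv.toHomeomorph.image_closure F).symm
    rw [← heq.image_eq, image_comp, affineEquiv_image_vadd, ← hcl,
      closure_vadd_eq_of_vadd_eq h1]

namespace SphericalSectorFace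

theorem germ_eq {s : S.SphericalSectorFace} {f : V → X} {x : V} {F : Set V}
    (h : S.Presents s.1 f x F) : s.germ = map f (sectorFaceGerm x F) := by
  refine le_antisymm ?_ ?_
  · exact (iInf_le _ f).trans ((iInf_le _ x).trans ((iInf_le _ F).trans (iInf_le _ h)))
  · exact le_iInf fun f' => le_iInf fun x' => le_iInf fun F' => le_iInf fun h' =>
      (presents_compare h h').1.le

theorem closure_eq {s : S.SphericalSectorFace} {f : V → X} {x : V} {F : Set V}
    (h : S.Presents s.1 f x F) : s.closure = f '' (x +ᵥ _root_.closure F) := by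
  refine Subset.antisymm ?_ ?_
  · exact iUnion_subset fun f' => iUnion_subset fun x' => iUnion_subset fun F' =>
      iUnion_subset fun h' => (presents_compare h h').2.ge
  · intro v hv
    simp only [closure, mem_iUnion]
    exact ⟨f, x, F, h, hv⟩

theorem germ_ofChart {f : V → X} (hf : S.IsChart f) {F : Set V} (hF : 𝔸.IsSphericalVFacet F)
    (x : V) : (ofChart hf hF x).germ = map f (sectorFaceGerm x F) :=
  germ_eq ⟨hf, hF, rfl⟩

theorem closure_ofChart {f : V → X} (hf : S.IsChart f) {F : Set V} (hF : 𝔸.IsSphericalVFacet F)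
    (x : V) : (ofChart hf hF x).closure = f '' (x +ᵥ _root_.closure F) :=
  closure_eq ⟨hf, hF, rfl⟩

/-- Every spherical sector face has a chimney germ which is contained in the same apartments. -/
theorem exists_chimneyGerm (s : S.SphericalSectorFace) :
    ∃ K : Filter X, S.IsOfKind 𝔸.IsSplayedChimneyGerm K ∧ S.IsOfKind 𝔸.IsSolidChimneyGerm K ∧
      s.germ ≤ K ∧ ∀ A ∈ S.apts, A ∈ s.germ → A ∈ K := by
  obtain ⟨f, x, F, h⟩ := s.2
  have hg := germ_eq h
  obtain ⟨⟨A, hA, hf⟩, hF, -⟩ := h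
  refine ⟨map f (𝔸.chimneyGerm x (𝔸.stdFacet univ) F),
    ⟨A, hA, f, hf, _, isSplayedChimneyGerm (𝔸.isVFacet_stdFacet univ) hF x, rfl⟩,
    isOfKind_chimneyGerm hA hf hF x, ?_, fun A' hA' h' => ?_⟩
  · rw [hg]
    exact map_mono (sectorFaceGerm_le_chimneyGerm x (𝔸.isVFacet_stdFacet univ))
  · rw [hg] at h'
    exact mem_map_chimneyGerm hA hA' hf hF h'

/-- `A` contains a shortening of the face. It has the same germ and, by `exists_chart_closure`, is a
sector face in the charts of `A`. -/
theorem exists_germ_eq {s : S.SphericalSectorFace} {A : Set X} (hA : A ∈ S.apts)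
    (h : A ∈ s.germ) {f : V → X} (hf : f ∈ S.isom A) :
    ∃ x F, 𝔸.IsSphericalVFacet F ∧ s.germ = map f (sectorFaceGerm x F) := by
  obtain ⟨f₀, x, F, hp⟩ := s.2
  have hg := germ_eq hp
  obtain ⟨⟨A₀, hA₀, hf₀⟩, hF, -⟩ := hp
  rw [hg] at h
  obtain ⟨ξ, hξ, hsub⟩ := (mem_sectorFaceGerm hF.isVFacet).1 h
  obtain ⟨f', hf', heq⟩ := exists_chart_closure hA₀ hA hf₀ hF (x := x + ξ)
    (image_subset_iff.2 hsub)
  obtain ⟨w, hw, rfl⟩ := exists_weyl hA hf hf'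
  refine ⟨w (x + ξ), w.linear '' F, hF.image (linear_mem_Wv hw), ?_⟩
  rw [← map_comp_sectorFaceGerm hw hF, hg, ← sectorFaceGerm_add hF.isVFacet x hξ]
  exact (map_sectorFaceGerm_congr (vadd_mem_sectorFaceGerm hF.isVFacet _)
    (heq.mono (vadd_set_mono subset_closure))).symm

theorem exists_hasDirections (s u : S.SphericalSectorFace) :
    ∃ F G, S.HasDirections s.germ u.germ F G := by
  obtain ⟨K, hK, -, hle, -⟩ := s.exists_chimneyGerm
  obtain ⟨L, -, hL, hle', -⟩ := u.exists_chimneyGerm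
  obtain ⟨A, hA, hAK, hAL⟩ := S.ma3 K L hK (Or.inr hL)
  obtain ⟨f, hf⟩ := S.isom_nonempty A hA
  obtain ⟨x, F, hF, hs⟩ := exists_germ_eq hA (hle hAK) hf
  obtain ⟨y, G, hG, hu⟩ := exists_germ_eq hA (hle' hAL) hf
  exact ⟨F, G, hF, hG, f, ⟨A, hA, hf⟩, x, y, hs, hu⟩

/-- The directions of two germs can be read in any apartment containing both. -/
theorem _root_.Hovel.AffineHovel.HasDirections.exists_chart {γ : Filter X}
    {u : S.SphericalSectorFace} {F G : Set V} (h : S.HasDirections γ u.germ F G) {B : Set X}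
    (hB : B ∈ S.apts) (hBγ : B ∈ γ) (hBu : B ∈ u.germ) :
    ∃ f ∈ S.isom B, ∃ x y, γ = map f (sectorFaceGerm x F) ∧
      u.germ = map f (sectorFaceGerm y G) := by
  obtain ⟨hF, hG, f, ⟨A, hA, hf⟩, x, y, rfl, hu⟩ := h
  obtain ⟨K, -, hK, hle, hmem⟩ := u.exists_chimneyGerm
  have hAu : A ∈ u.germ := by rw [hu]; exact mem_map_of_chart hA hf _
  obtain ⟨f', hf', Q, -, hQ₁, hQ₂, heq⟩ := exists_chart_of_ma4 hA hB hf hF hBγ (Or.inr hK)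
    (hmem A hA hAu) (hmem B hB hBu)
  have hQ₃ : Q ∈ sectorFaceGerm y G := by
    have := comap_mono hle hQ₂
    rwa [hu, comap_map (S.isom_injective A hA f hf)] at this
  exact ⟨f', hf', x, y, (map_sectorFaceGerm_congr hQ₁ heq).symm,
    hu.trans (map_sectorFaceGerm_congr hQ₃ heq).symm⟩

/-- The pair of directions of two germs is unique up to the vectorial Weyl group. -/
theorem _root_.Hovel.AffineHovel.HasDirections.exists_weyl {γ : Filter X}
    {u : S.SphericalSectorFace} {F G F' G' : Set V} (h : S.HasDirections γ u.germ F G)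
    (h' : S.HasDirections γ u.germ F' G') :
    ∃ w : V ≃ₗ[ℝ] V, F' = w '' F ∧ G' = w '' G := by
  obtain ⟨hF', hG', f, ⟨A, hA, hf⟩, x, y, hγ, hu⟩ := h'
  obtain ⟨f', hf', x', y', hγ', hu'⟩ := h.exists_chart hA
    (by rw [hγ]; exact mem_map_of_chart hA hf _) (by rw [hu]; exact mem_map_of_chart hA hf _)
  obtain ⟨w, hw, rfl⟩ := AffineHovel.exists_weyl hA hf hf'
  rw [map_comp_sectorFaceGerm hw h.1] at hγ'
  rw [map_comp_sectorFaceGerm hw h.2.1] at hu'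
  exact ⟨w.linear, direction_unique ⟨A, hA, hf⟩ hF' (h.1.image (linear_mem_Wv hw))
    (hγ.symm.trans hγ'), direction_unique ⟨A, hA, hf⟩ hG' (h.2.1.image (linear_mem_Wv hw))
    (hu.symm.trans hu')⟩

/-! ### Parallelism -/

/-- The relative position of two sector faces depends only on the parallelism class of the
first. -/
theorem Parallel.hasDirections {s t u : S.SphericalSectorFace} (hst : s.Parallel t) {F G : Set V}
    (h : S.HasDirections s.germ u.germ F G) : S.HasDirections t.germ u.germ F G := by
  obtain ⟨f, hf, x, y, E, hE, hs, ht⟩ := hst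
  obtain ⟨K, -, hK, hle, hmem⟩ := u.exists_chimneyGerm
  rw [hs] at h
  rw [ht]
  refine germ_invariant (Φ := fun γ => S.HasDirections γ u.germ F G) (Or.inr hK) ?_ hf hE h
  -- In `B` both directions are read in one chart, where passing from `p` to `p'` only changes the
  -- base point.
  intro B hB hBK h hh p p' H hH hd
  obtain ⟨f', hf', a, b, ha, hb⟩ := hd.exists_chart hB (mem_map_of_chart hB hh _) (hle hBK)
  obtain ⟨w, hw, rfl⟩ := AffineHovel.exists_weyl hB hh hf'
  refine ⟨hd.1, hd.2.1, h ∘ w, ⟨B, hB, hf'⟩, w.symm p', b, ?_, hb⟩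
  rw [map_comp_sectorFaceGerm hw hd.1] at ha ⊢
  rw [← direction_unique ⟨B, hB, hh⟩ hH (hd.1.image (linear_mem_Wv hw)) ha,
    AffineEquiv.apply_symm_apply]

theorem Parallel.trans {s t u : S.SphericalSectorFace} (h : s.Parallel t) (h' : t.Parallel u) :
    s.Parallel u := by
  obtain ⟨F, h'⟩ := parallel_iff.1 h'
  exact parallel_iff.2 ⟨F, h.symm.hasDirections h'⟩

theorem Parallel.refl (s : S.SphericalSectorFace) : s.Parallel s := by
  obtain ⟨f, x, F, h⟩ := s.2
  exact parallel_of_germ_eq h.1 h.2.1 (germ_eq h) (germ_eq h)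

/-- Parallelism on both sides preserves the relative position. -/
theorem Parallel.hasDirections₂ {s s₁ t t₁ : S.SphericalSectorFace} (hs : s₁.Parallel s)
    (ht : t.Parallel t₁) {F G : Set V} (h : S.HasDirections s.germ t.germ F G) :
    S.HasDirections s₁.germ t₁.germ F G :=
  (ht.hasDirections (hs.symm.hasDirections h).symm).symm

/-! ### Dominance -/

theorem Dominates.of_parallel {s s₁ t t₁ : S.SphericalSectorFace} (hs : s₁.Parallel s)
    (h : s.Dominates t) (ht : t.Parallel t₁) : s₁.Dominates t₁ := by
  obtain ⟨F, F', hsub, h⟩ := dominates_iff.1 h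
  exact dominates_iff.2 ⟨F, F', hsub, hs.hasDirections₂ ht h⟩

/-- A sector face dominated by `s` is parallel to a face of `s`, in any chart containing the germ of
`s`. -/
theorem Dominates.exists_face {s t : S.SphericalSectorFace} (h : s.Dominates t) {f : V → X}
    (hf : S.IsChart f) {F : Set V} (hF : 𝔸.IsSphericalVFacet F) {x : V}
    (hs : s.germ = map f (sectorFaceGerm x F)) :
    ∃ (F' : Set V) (hF' : 𝔸.IsSphericalVFacet F'), F' ⊆ _root_.closure F ∧
      ∀ y, t.Parallel (ofChart hf hF' y) := by
  obtain ⟨f₁, hf₁', x₁, y₁, F₁, F₁', hF₁, hF₁', hsub, hs₁, ht₁⟩ := h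
  obtain ⟨A₁, hA₁, hf₁⟩ := id hf₁'
  obtain ⟨A, hA, hfA⟩ := id hf
  have hA' : A ∈ map f₁ (sectorFaceGerm x₁ F₁) := by
    rw [← hs₁, hs]; exact mem_map_of_chart hA hfA _
  -- A shortening of `s` lies in both apartments, and so does its closure. Its face of direction
  -- `F₁'` is parallel to `t` and can be moved freely in the apartment of `f`.
  obtain ⟨ξ, hξ, hA''⟩ := (mem_sectorFaceGerm hF₁.isVFacet).1 hA'
  obtain ⟨f', hf', heq⟩ := exists_chart_closure hA₁ hA hf₁ hF₁ (image_subset_iff.2 hA'')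
  obtain ⟨w, hw, rfl⟩ := AffineHovel.exists_weyl hA hfA hf'
  have hF' := hF₁'.image (linear_mem_Wv hw)
  have hFeq : F = w.linear '' F₁ := by
    refine direction_unique hf hF (hF₁.image (linear_mem_Wv hw)) (x := x) (y := w (x₁ + ξ)) ?_
    rw [← hs, ← map_comp_sectorFaceGerm hw hF₁, hs₁, ← sectorFaceGerm_add hF₁.isVFacet x₁ hξ]
    exact (map_sectorFaceGerm_congr (vadd_mem_sectorFaceGerm hF₁.isVFacet _)
      (heq.mono (vadd_set_mono subset_closure))).symm
  have ht₂ : (ofChart hf₁' hF₁' (x₁ + ξ)).germ =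
      map f (sectorFaceGerm (w (x₁ + ξ)) (w.linear '' F₁')) := by
    rw [germ_ofChart, ← map_comp_sectorFaceGerm hw hF₁']
    exact (map_sectorFaceGerm_congr (vadd_mem_sectorFaceGerm hF₁'.isVFacet _)
      (heq.mono (vadd_set_mono hsub))).symm
  refine ⟨w.linear '' F₁', hF', ?_, fun y => ?_⟩
  · have hcl : _root_.closure (w.linear '' F₁) = w.linear '' _root_.closure F₁ :=
      (w.linear.toContinuousLinearEquiv.toHomeomorph.image_closure F₁).symm
    rw [hFeq, hcl]
    exact image_mono hsub
  · exact (parallel_of_germ_eq hf₁' hF₁' ht₁ (germ_ofChart _ _ _)).trans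
      (parallel_of_germ_eq hf hF' ht₂ (germ_ofChart _ _ _))

theorem Dominates.hasDirections {s t u : S.SphericalSectorFace} (h : s.Dominates t) {F G : Set V}
    (hd : S.HasDirections s.germ u.germ F G) :
    ∃ F', F' ⊆ _root_.closure F ∧ S.HasDirections t.germ u.germ F' G := by
  obtain ⟨hF, hG, f, hf, x, y, hs, hu⟩ := hd
  obtain ⟨F', hF', hsub, hp⟩ := h.exists_face hf hF hs
  exact ⟨F', hsub, (hp x).symm.hasDirections
    ⟨hF', hG, f, hf, x, y, germ_ofChart _ _ _, hu⟩⟩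

theorem Dominates.trans {s t u : S.SphericalSectorFace} (h : s.Dominates t)
    (h' : t.Dominates u) : s.Dominates u := by
  obtain ⟨F, F', hsub, hd⟩ := dominates_iff.1 h
  obtain ⟨F'', hsub', hd'⟩ := h'.hasDirections hd.symm
  exact dominates_iff.2 ⟨F, F'', hsub'.trans (closure_minimal hsub isClosed_closure), hd'.symm⟩

/-- Uniqueness of the pair of directions carries the second inclusion into the chart of the first,
where each facet is in the closure of the other. -/
theorem parallel_of_dominates {s t : S.SphericalSectorFace} (h : s.Dominates t)
    (h' : t.Dominates s) : s.Parallel t := by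
  obtain ⟨F, F', hsub, hd⟩ := dominates_iff.1 h
  obtain ⟨G, G', hsub', hd'⟩ := dominates_iff.1 h'
  obtain ⟨w, rfl, rfl⟩ := hd.exists_weyl hd'.symm
  have hcl : _root_.closure (w '' F') = w '' _root_.closure F' :=
    (w.toContinuousLinearEquiv.toHomeomorph.image_closure F').symm
  rw [hcl, image_subset_image_iff w.injective] at hsub'
  obtain rfl := facet_eq_of_subset_closure hd.1.isVFacet hd.2.1.isVFacet hsub' hsub
  exact parallel_iff.2 ⟨F, hd⟩

/-! ### Dominance and inclusion in closures -/

theorem dominates_of_subset_closure {s t : S.SphericalSectorFace} (h : t.1 ⊆ s.closure) :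
    s.Dominates t := by
  obtain ⟨f, x, F, hp⟩ := s.2
  obtain ⟨g, y, G, hq⟩ := t.2
  have hs := germ_eq hp
  have ht := germ_eq hq
  rw [closure_eq hp, hq.2.2] at h
  obtain ⟨⟨A, hA, hf⟩, hF, -⟩ := hp
  obtain ⟨⟨B, hB, hg⟩, hG, -⟩ := hq
  obtain ⟨g', hg', heq⟩ := exists_chart_closure hB hA hg hG (x := y) (h.trans (by
    rw [← S.isom_range A hA f hf]; exact image_subset_range _ _))
  obtain ⟨w, hw, rfl⟩ := AffineHovel.exists_weyl hA hf hg'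
  have heq' : EqOn (f ∘ w) g (y +ᵥ G) := heq.mono (vadd_set_mono subset_closure)
  have hwG := hG.image (linear_mem_Wv hw)
  rw [← heq'.image_eq, image_comp, image_subset_image_iff (S.isom_injective A hA f hf),
    affineEquiv_image_vadd] at h
  refine dominates_iff.2 ⟨F, _, subset_closure_of_vadd_subset hF.isVFacet hwG.isVFacet h, hF, hwG,
    f, ⟨A, hA, hf⟩, x, w y, hs, ?_⟩
  rw [ht, ← map_comp_sectorFaceGerm hw hG]
  exact (map_sectorFaceGerm_congr (vadd_mem_sectorFaceGerm hG.isVFacet _) heq').symm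

theorem Dominates.exists_parallel_subset {s t : S.SphericalSectorFace} (h : s.Dominates t) :
    ∃ t₁ : S.SphericalSectorFace, t₁.Parallel t ∧ t₁.1 ⊆ s.closure := by
  obtain ⟨f, x, F, hp⟩ := s.2
  obtain ⟨F', hF', hsub, hpar⟩ := h.exists_face hp.1 hp.2.1 (germ_eq hp)
  refine ⟨_, (hpar x).symm, ?_⟩
  rw [closure_eq hp]
  exact image_mono (vadd_set_mono hsub)

theorem mem_map_facet {A B : Set X} (hA : A ∈ S.apts) (hB : B ∈ S.apts) {g : V → X}
    (hg : g ∈ S.isom A) {y : V} (hy : g y ∈ B) : B ∈ map g (𝔸.facet y (𝔸.stdFacet univ)) := by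
  obtain ⟨f', hf', Q, hQ, hQy, heq⟩ := exists_chart_of_ma2 hA hB hg (H := 𝓟 {y})
    (Or.inl ⟨y, rfl⟩) (by simpa using hy)
  have hy' : y ∈ Q := by simpa using hQy
  rw [mem_map]
  refine ⟨Q, hQ.isSemiEnclosed, mem_of_superset self_mem_nhdsWithin ?_, fun v hv =>
    mem_of_chart_eq hB hf' (heq v hv)⟩
  rintro _ ⟨u, hu, rfl⟩
  exact hQ.add_mem (𝔸.isVFacet_stdFacet univ) (a := y) (zero_mem_stdFacet_univ (𝔸 := 𝔸))
    (fun t _ => by simpa using hy') hy' (subset_closure hu)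

/-- Parallel sector faces with the same base point are equal. -/
theorem eq_of_parallel {t : S.SphericalSectorFace} {g : V → X} {y : V} {G : Set V}
    (ht : S.Presents t.1 g y G) {f : V → X} (hf : S.IsChart f) {q : V} (hq : f q = g y)
    {F : Set V} (hF : 𝔸.IsSphericalVFacet F) (h : t.Parallel (ofChart hf hF q)) :
    t.1 = f '' (q +ᵥ F) := by
  have htg := germ_eq ht
  obtain ⟨⟨A, hA, hg⟩, hG, htG⟩ := ht
  set K := map g (𝔸.facet y (𝔸.stdFacet univ))
  have hK : S.IsOfKind 𝔸.IsFacet K :=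
    ⟨A, hA, g, hg, _, ⟨y, _, 𝔸.isVFacet_stdFacet univ, rfl⟩, rfl⟩
  -- `Φ γ`: in some apartment, `t` is the sector face from the point `g y` with the direction of the
  -- germ `γ`.
  let Φ : Filter X → Prop := fun γ => ∃ B ∈ S.apts, ∃ h ∈ S.isom B, ∃ a p H,
    𝔸.IsSphericalVFacet H ∧ h a = g y ∧ γ = map h (sectorFaceGerm p H) ∧ t.1 = h '' (a +ᵥ H)
  have core : ∀ B ∈ S.apts, g y ∈ B → ∀ h ∈ S.isom B, ∀ (p : V) (H : Set V),
      𝔸.IsSphericalVFacet H → Φ (map h (sectorFaceGerm p H)) →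
      ∃ a, h a = g y ∧ t.1 = h '' (a +ᵥ H) := by
    rintro B hB hyB h hh p H hH ⟨C, hC, k, hk, a, p₁, H₁, hH₁, hka, hγ, htk⟩
    have hyC : g y ∈ C := by
      rw [← hka, ← S.isom_range C hC k hk]; exact mem_range_self a
    -- (MA4) for the germ and the facet of the point: the shared enclosed set contains the point and
    -- is stable under the closure of the direction, so it contains all of `t`.
    obtain ⟨k', hk', Q, hQ, hQ₁, ⟨T, hT, hTQ⟩, heq⟩ := exists_chart_of_ma4 hC hB hk hH₁
      (by rw [← hγ]; exact mem_map_of_chart hB hh _) (Or.inl hK) (mem_map_facet hA hC hg hyC)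
      (mem_map_facet hA hB hg hyB)
    have haQ : a ∈ Q := hTQ (by
      rw [mem_preimage, hka]
      exact mem_facet_stdFacet_univ (M := g ⁻¹' T) hT)
    obtain ⟨w, hw, rfl⟩ := AffineHovel.exists_weyl hB hh hk'
    have hHeq : H = w.linear '' H₁ := by
      refine direction_unique ⟨B, hB, hh⟩ hH (hH₁.image (linear_mem_Wv hw)) (x := p)
        (y := w p₁) ?_
      rw [hγ, ← map_comp_sectorFaceGerm hw hH₁, map_sectorFaceGerm_congr hQ₁ heq]
    refine ⟨w a, (heq a haQ).trans hka, ?_⟩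
    rw [htk, hHeq, ← affineEquiv_image_vadd, ← image_comp]
    refine EqOn.image_eq ?_
    rintro _ ⟨u, hu, rfl⟩
    exact (heq _ (hQ.add_mem_of_germ hH₁.isVFacet hQ₁ haQ (subset_closure hu))).symm
  obtain ⟨k, hk, b, b', E, hE, hb, hb'⟩ := h
  have h1 : Φ t.germ := ⟨A, hA, g, hg, y, y, G, hG, rfl, htg, htG⟩
  have h2 : Φ (ofChart hf hF q).germ := by
    rw [hb] at h1
    rw [hb']
    refine germ_invariant (Or.inl hK) ?_ hk hE h1
    intro B hB hBK h hh p p' H hH hΦ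
    obtain ⟨a, ha, hta⟩ := core B hB (mem_facet_stdFacet_univ (M := g ⁻¹' B) hBK) h hh p H hH hΦ
    exact ⟨B, hB, h, hh, a, p', H, hH, ha, rfl, hta⟩
  rw [germ_ofChart] at h2
  obtain ⟨B, hB, hfB⟩ := id hf
  obtain ⟨a, ha, hta⟩ := core B hB (by
    rw [← hq, ← S.isom_range B hB f hfB]; exact mem_range_self q) f hfB q F hF h2
  rw [hta, hf.injective (ha.trans hq.symm)]

/-- (MA3) gives an apartment with the base point of `t` and the germ of `s`. The face parallel to
`s` from that point has a face parallel to `t` with the same origin, which is `t` by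
`eq_of_parallel`. -/
theorem Dominates.exists_parallel_superset {s t : S.SphericalSectorFace} (h : s.Dominates t) :
    ∃ s₁ : S.SphericalSectorFace, s₁.Parallel s ∧ t.1 ⊆ s₁.closure := by
  obtain ⟨g, y, G, hp⟩ := t.2
  obtain ⟨A, hA, hg⟩ := hp.1
  obtain ⟨K, hK, -, hle, -⟩ := s.exists_chimneyGerm
  obtain ⟨B, hB, hBK, hBy⟩ := S.ma3 K (map g (𝔸.facet y (𝔸.stdFacet univ))) hK
    (Or.inl ⟨A, hA, g, hg, _, ⟨y, _, 𝔸.isVFacet_stdFacet univ, rfl⟩, rfl⟩)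
  have hyB : g y ∈ B := mem_facet_stdFacet_univ (M := g ⁻¹' B) hBy
  obtain ⟨f, hf⟩ := S.isom_nonempty B hB
  obtain ⟨x, F, hF, hs⟩ := exists_germ_eq hB (hle hBK) hf
  rw [← S.isom_range B hB f hf] at hyB
  obtain ⟨q, hq⟩ := hyB
  have hfc : S.IsChart f := ⟨B, hB, hf⟩
  obtain ⟨F', hF', hsub, hpar⟩ := h.exists_face hfc hF hs
  refine ⟨ofChart hfc hF q, parallel_of_germ_eq hfc hF (germ_ofChart _ _ _) hs, ?_⟩
  rw [closure_ofChart, eq_of_parallel hp hfc hq hF' (hpar q)]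
  exact image_mono (vadd_set_mono hsub)

/-! ### Opposition -/

theorem neg_subset_closure_neg {V : Type*} [NormedAddCommGroup V] {F F' : Set V}
    (h : F' ⊆ _root_.closure F) :
    -F' ⊆ _root_.closure (-F) := by
  rw [← neg_closure]
  exact neg_subset_neg.2 h

theorem Opposite.of_parallel {s s₁ t t₁ : S.SphericalSectorFace} (hs : s₁.Parallel s)
    (h : s.Opposite t) (ht : t.Parallel t₁) : s₁.Opposite t₁ := by
  obtain ⟨F, h⟩ := opposite_iff.1 h
  exact opposite_iff.2 ⟨F, hs.hasDirections₂ ht h⟩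

/-- Opposite faces have opposite directions in any chart. -/
theorem Opposite.eq_neg {s t : S.SphericalSectorFace} (h : s.Opposite t) {F G : Set V}
    (hd : S.HasDirections s.germ t.germ F G) : G = -F := by
  obtain ⟨E, h⟩ := opposite_iff.1 h
  obtain ⟨w, rfl, rfl⟩ := h.exists_weyl hd
  exact image_neg_of_apply_neg_eq_neg fun x _ => map_neg w x

/-- If `s` and `u` have directions `F` and `G` in a common apartment, both sides mean that `-G` lies
in the closure of `F`. The witnesses are the faces of direction `-G` and `-F` from the base point of
`s`. -/
theorem exists_opposite_dominates_iff (s u : S.SphericalSectorFace) :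
    (∃ t : S.SphericalSectorFace, s.Opposite t ∧ t.Dominates u) ↔
      ∃ t₁ : S.SphericalSectorFace, s.Dominates t₁ ∧ t₁.Opposite u := by
  constructor
  · rintro ⟨t, hst, htu⟩
    obtain ⟨F, hd⟩ := opposite_iff.1 hst
    obtain ⟨G, hsub, hG, hF, f, hf, y, x, hu, hs⟩ := htu.hasDirections hd.symm
    refine ⟨ofChart hf hG.neg x, ⟨f, hf, x, x, F, -G, hF, hG.neg, ?_, hs, germ_ofChart _ _ _⟩,
      ⟨f, hf, x, y, -G, hG.neg, germ_ofChart _ _ _, by rwa [neg_neg]⟩⟩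
    simpa using neg_subset_closure_neg hsub
  · rintro ⟨t, hst, htu⟩
    obtain ⟨F, G, hd⟩ := exists_hasDirections s u
    obtain ⟨F', hsub, hd'⟩ := hst.hasDirections hd
    obtain rfl := htu.eq_neg hd'
    obtain ⟨hF, hG, f, hf, x, y, hs, hu⟩ := hd
    exact ⟨ofChart hf hF.neg x, ⟨f, hf, x, x, F, hF, hs, germ_ofChart _ _ _⟩,
      ⟨f, hf, x, y, -F, -F', hF.neg, hG, neg_subset_closure_neg hsub, germ_ofChart _ _ _, hu⟩⟩

end SphericalSectorFace

end AffineHovel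

end Hovel

open Hovel.AffineHovel.SphericalSectorFace in
theorem proposition3p2 {V ι : Type*} [NormedAddCommGroup V] [NormedSpace ℝ V]
    [FiniteDimensional ℝ V] [Fintype ι] (𝔸 : Hovel.Apartment V ι) {X : Type*}
    (S : Hovel.AffineHovel 𝔸 X) :
    -- parallelism is an equivalence relation
    Equivalence (fun s t : S.SphericalSectorFace => s.Parallel t) ∧
    -- dominance is a preorder, compatible with parallelism
    (∀ s : S.SphericalSectorFace, s.Dominates s) ∧
    (∀ s t u : S.SphericalSectorFace, s.Dominates t → t.Dominates u → s.Dominates u) ∧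
    (∀ s s₁ t t₁ : S.SphericalSectorFace,
      s₁.Parallel s → s.Dominates t → t.Parallel t₁ → s₁.Dominates t₁) ∧
    -- parallelism is the equivalence relation associated with dominance
    (∀ s t : S.SphericalSectorFace, s.Parallel t ↔ s.Dominates t ∧ t.Dominates s) ∧
    -- dominance in terms of closures
    (∀ s t : S.SphericalSectorFace,
      s.Dominates t ↔ ∃ t₁ : S.SphericalSectorFace, t₁.Parallel t ∧ t₁.1 ⊆ s.closure) ∧
    (∀ s t : S.SphericalSectorFace,
      s.Dominates t ↔ ∃ s₁ : S.SphericalSectorFace, s₁.Parallel s ∧ t.1 ⊆ s₁.closure) ∧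
    -- opposition is symmetric, and compatible with parallelism and dominance
    (∀ s t : S.SphericalSectorFace, s.Opposite t → t.Opposite s) ∧
    (∀ s s₁ t t₁ : S.SphericalSectorFace,
      s₁.Parallel s → s.Opposite t → t.Parallel t₁ → s₁.Opposite t₁) ∧
    (∀ s u : S.SphericalSectorFace,
      (∃ t : S.SphericalSectorFace, s.Opposite t ∧ t.Dominates u) ↔
        ∃ t₁ : S.SphericalSectorFace, s.Dominates t₁ ∧ t₁.Opposite u) ∧
    (∀ s u : S.SphericalSectorFace,
      (∃ t : S.SphericalSectorFace, s.Opposite t ∧ u.Dominates t) ↔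
        ∃ t₁ : S.SphericalSectorFace, t₁.Dominates s ∧ t₁.Opposite u) := by
  refine ⟨⟨.refl, .symm, .trans⟩, fun s => (Parallel.refl s).dominates,
    fun s t u => .trans, fun s s₁ t t₁ => .of_parallel,
    fun s t => ⟨fun h => ⟨h.dominates, h.symm.dominates⟩, fun h => parallel_of_dominates h.1 h.2⟩,
    fun s t => ⟨fun h => h.exists_parallel_subset, fun ⟨t₁, h, hsub⟩ =>
      (dominates_of_subset_closure hsub).of_parallel (.refl s) h⟩,
    fun s t => ⟨fun h => h.exists_parallel_superset, fun ⟨s₁, h, hsub⟩ =>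
      (dominates_of_subset_closure hsub).of_parallel h.symm (.refl t)⟩,
    fun s t => .symm, fun s s₁ t t₁ => .of_parallel, exists_opposite_dominates_iff,
    fun s u => ?_⟩
  -- By symmetry of opposition, this is the previous equivalence with `s` and `u` exchanged.
  calc (∃ t : S.SphericalSectorFace, s.Opposite t ∧ u.Dominates t)
    _ ↔ ∃ t : S.SphericalSectorFace, u.Dominates t ∧ t.Opposite s :=
      exists_congr fun t => ⟨fun h => ⟨h.2, h.1.symm⟩, fun h => ⟨h.2.symm, h.1⟩⟩
    _ ↔ ∃ t : S.SphericalSectorFace, u.Opposite t ∧ t.Dominates s :=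
      (exists_opposite_dominates_iff u s).symm
    _ ↔ ∃ t : S.SphericalSectorFace, t.Dominates s ∧ t.Opposite u :=
      exists_congr fun t => ⟨fun h => ⟨h.2, h.1.symm⟩, fun h => ⟨h.2.symm, h.1⟩⟩
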